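/- Let $\Bbbk$ be a field of characteristic $0$ and let $L$ be a Lie superalgebra over $\Bbbk$ with a decomposition $L=K\oplus V$ into a direct sum of two ($\mathbb Z_2$-graded) subalgebras, where $V$ is Abelian; let $P\colon L\to V$ be the projector on $V$ parallel to $K$. Let $\mathrm{Der}_K L$ be the Lie superalgebra (with respect to the supercommutator) of all derivations $D$ of $L$, in the $\mathbb Z_2$-graded sense, such that $D(K)\subset K$. For $D\in \mathrm{Der}_K L$ the higher derived brackets of $D$ are the operations on $V$ $$\{a_1,\dots,a_k\}_D=P[\dots[[Da_1,a_2],a_3],\dots,a_k],\qquad k=1,2,3,\dots,$$ and the $0$-ary bracket is set to be zero. Let $\mathrm{Vect}\,V$ be the Lie superalgebra of formal vector fields on $V$, i.e. of the superderivations, continuous with respect to coefficientwise convergence, of the algebra of formal power series (formal functions) on the superspace $V$, with the supercommutator; vectors $u\in V$ are regarded as vector fields $\partial_u$ with constant coefficients, and $X(0)=v$ means that $(Xf)(0)=(\partial_v f)(0)$ for all formal functions $f$. Then for each $D\in\mathrm{Der}_K L$ there is a unique formal vector field $Q_D\in\mathrm{Vect}\,V$ that encodes all higher derived brackets of $D$,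 i.e. such that $Q_D(0)=0$ and $$[\dots[[Q_D,u_1],u_2],\dots,u_k](0)=\{u_1,\dots,u_k\}_D\qquad\text{for all } k\geq 1,\ u_1,\dots,u_k\in V,$$ and the map $D\mapsto Q_D$ is a homomorphism of Lie superalgebras $\mathrm{Der}_K L\to\mathrm{Vect}\,V$: it is linear, it preserves parity, and $$[Q_{D_1},Q_{D_2}]=Q_{[D_1,D_2]}\qquad\text{for all } D_1,D_2\in\mathrm{Der}_K L.$$ -/

import Mathlib

noncomputable section

/-- The sign `(-1)^{ij}` for parities `i, j`. -/
def superSign (𝕜 : Type*) [Field 𝕜] (i j : ZMod 2) : 𝕜 := if i = 1 ∧ j = 1 then -1 else 1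

section
variable (𝕜 : Type*) [Field 𝕜]

theorem superSign_zero_left (j : ZMod 2) : superSign 𝕜 0 j = 1 := by
  simp [superSign, show (0 : ZMod 2) ≠ 1 by decide]

theorem superSign_zero_right (i : ZMod 2) : superSign 𝕜 i 0 = 1 := by
  simp [superSign, show (0 : ZMod 2) ≠ 1 by decide]

theorem superSign_one_one : superSign 𝕜 1 1 = -1 := by
  simp [superSign]

end

theorem parity_cases (i : ZMod 2) : i = 0 ∨ i = 1 := by
  revert i; decide

theorem parity_one_add_one : (1 + 1 : ZMod 2) = 0 := by
  decide

/-- A super (that is, `ℤ/2`-graded) vector space `V = V₀ ⊕ V₁`. -/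
class Superspace (𝕜 : Type*) (V : Type*) [Field 𝕜] [AddCommGroup V] [Module 𝕜 V] where
  part : ZMod 2 → Submodule 𝕜 V
  isCompl : IsCompl (part 0) (part 1)

namespace Superspace

section
variable (𝕜 : Type*) {V : Type*} [Field 𝕜] [AddCommGroup V] [Module 𝕜 V] [Superspace 𝕜 V]

/-- The projector on the even part. -/
def even : V →ₗ[𝕜] V := (part (𝕜 := 𝕜) (V := V) 0).projection (part 1) isCompl

/-- The projector on the odd part. -/
def odd : V →ₗ[𝕜] V := (part (𝕜 := 𝕜) (V := V) 1).projection (part 0) isCompl.symm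

/-- The parity involution: `x ↦ (-1)^{|x|} x` on homogeneous `x`. -/
def invol : V →ₗ[𝕜] V := even 𝕜 - odd 𝕜

theorem even_mem (x : V) : even 𝕜 x ∈ part (𝕜 := 𝕜) (V := V) 0 :=
  Submodule.projection_apply_mem _ _

theorem odd_mem (x : V) : odd 𝕜 x ∈ part (𝕜 := 𝕜) (V := V) 1 :=
  Submodule.projection_apply_mem _ _

theorem even_add_odd (x : V) : even 𝕜 x + odd 𝕜 x = x :=
  Submodule.projection_add_projection_eq_self _ x

variable {𝕜}

theorem even_of_mem_zero {x : V} (h : x ∈ part (𝕜 := 𝕜) (V := V) 0) : even 𝕜 x = x :=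
  Submodule.projection_apply_of_mem_left _ h

theorem odd_of_mem_one {x : V} (h : x ∈ part (𝕜 := 𝕜) (V := V) 1) : odd 𝕜 x = x :=
  Submodule.projection_apply_of_mem_left _ h

theorem even_of_mem_one {x : V} (h : x ∈ part (𝕜 := 𝕜) (V := V) 1) : even 𝕜 x = 0 :=
  (Submodule.projection_apply_eq_zero_iff _).2 h

theorem odd_of_mem_zero {x : V} (h : x ∈ part (𝕜 := 𝕜) (V := V) 0) : odd 𝕜 x = 0 :=
  (Submodule.projection_apply_eq_zero_iff _).2 h

theorem invol_of_mem {i : ZMod 2} {x : V} (h : x ∈ part (𝕜 := 𝕜) (V := V) i) :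
    invol 𝕜 x = superSign 𝕜 1 i • x := by
  rcases parity_cases i with rfl | rfl
  · simp [invol, superSign_zero_right, even_of_mem_zero h, odd_of_mem_zero h]
  · simp [invol, superSign_one_one, even_of_mem_one h, odd_of_mem_one h]

theorem invol_invol (x : V) : invol 𝕜 (invol 𝕜 x) = x := by
  simp only [invol, LinearMap.sub_apply, map_sub, even_of_mem_zero (even_mem 𝕜 x),
    even_of_mem_one (odd_mem 𝕜 x), odd_of_mem_one (odd_mem 𝕜 x), odd_of_mem_zero (even_mem 𝕜 x)]
  simpa using even_add_odd 𝕜 x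

theorem hom_induction {p : V → Prop} (x : V) (hadd : ∀ x y, p x → p y → p (x + y))
    (hom : ∀ i, ∀ x ∈ part (𝕜 := 𝕜) (V := V) i, p x) : p x := by
  rw [← even_add_odd 𝕜 x]
  exact hadd _ _ (hom 0 _ (even_mem 𝕜 x)) (hom 1 _ (odd_mem 𝕜 x))

end

/-- A linear endomorphism has parity `i` if it sends vectors of parity `j` to vectors of
parity `i + j`. -/
instance endSuperspace (𝕜 : Type*) (V : Type*) [Field 𝕜] [AddCommGroup V] [Module 𝕜 V]
    [Superspace 𝕜 V] : Superspace 𝕜 (Module.End 𝕜 V) where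
  part i :=
    { carrier := {T | ∀ j, ∀ x ∈ part (𝕜 := 𝕜) (V := V) j, T x ∈ part (𝕜 := 𝕜) (V := V) (i + j)}
      add_mem' := fun hS hT j x hx => add_mem (hS j x hx) (hT j x hx)
      zero_mem' := fun j x _ => by simp
      smul_mem' := fun c T hT j x hx => Submodule.smul_mem _ c (hT j x hx) }
  isCompl := by
    constructor
    · rw [Submodule.disjoint_def]
      intro T h0 h1
      ext x
      refine hom_induction (𝕜 := 𝕜) (p := fun x => T x = 0) x
        (fun x y hx hy => by rw [map_add, hx, hy, add_zero]) fun i x hx => ?_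
      have a := h0 i x hx
      have b := h1 i x hx
      have d := Submodule.disjoint_def.1 (isCompl (𝕜 := 𝕜) (V := V)).disjoint (T x)
      rcases parity_cases i with rfl | rfl
      · exact d a b
      · exact d b a
    · rw [codisjoint_iff, eq_top_iff]
      intro T _
      rw [Submodule.mem_sup]
      refine ⟨even 𝕜 ∘ₗ T ∘ₗ even 𝕜 + odd 𝕜 ∘ₗ T ∘ₗ odd 𝕜, ?_,
        odd 𝕜 ∘ₗ T ∘ₗ even 𝕜 + even 𝕜 ∘ₗ T ∘ₗ odd 𝕜, ?_, ?_⟩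
      · intro j x hx
        rcases parity_cases j with rfl | rfl
        · simpa [odd_of_mem_zero hx] using even_mem 𝕜 (T (even 𝕜 x))
        · simpa [even_of_mem_one hx, parity_one_add_one] using odd_mem 𝕜 (T (odd 𝕜 x))
      · intro j x hx
        rcases parity_cases j with rfl | rfl
        · simpa [odd_of_mem_zero hx] using odd_mem 𝕜 (T (even 𝕜 x))
        · simpa [even_of_mem_one hx, parity_one_add_one] using even_mem 𝕜 (T (odd 𝕜 x))
      · ext x
        have h1 := even_add_odd 𝕜 (T (even 𝕜 x))
        have h2 := even_add_odd 𝕜 (T (odd 𝕜 x))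
        have h3 : T (even 𝕜 x) + T (odd 𝕜 x) = T x := by rw [← map_add, even_add_odd]
        simp only [LinearMap.add_apply, LinearMap.comp_apply]
        rw [← h3, ← congrArg₂ (· + ·) h1 h2]
        abel

end Superspace

open Superspace

/-- A Lie superalgebra over a field (of characteristic zero in what follows). -/
class LieSuperalgebra (𝕜 : Type*) (L : Type*) [Field 𝕜] [AddCommGroup L] [Module 𝕜 L]
    extends Superspace 𝕜 L where
  br : L →ₗ[𝕜] L →ₗ[𝕜] L
  br_mem : ∀ i j, ∀ x ∈ part i, ∀ y ∈ part j, br x y ∈ part (i + j)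
  br_skew : ∀ i j, ∀ x ∈ part i, ∀ y ∈ part j, br x y = -(superSign 𝕜 i j • br y x)
  br_jacobi : ∀ i j k, ∀ x ∈ part i, ∀ y ∈ part j, ∀ z ∈ part k,
    br x (br y z) = br (br x y) z + superSign 𝕜 i j • br y (br x z)

namespace LieSuperalgebra

/-- The supercommutator of endomorphisms: the bilinear map with
`[S, T] = S T - (-1)^{|S||T|} T S` for homogeneous `S`, `T`. -/
def supercomm (𝕜 : Type*) (V : Type*) [Field 𝕜] [AddCommGroup V] [Module 𝕜 V] [Superspace 𝕜 V] :
    Module.End 𝕜 V →ₗ[𝕜] Module.End 𝕜 V →ₗ[𝕜] Module.End 𝕜 V :=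
  LinearMap.mk₂ 𝕜 (fun S T => S * T - T * even 𝕜 S - invol 𝕜 T * odd 𝕜 S)
    (by intros; simp only [map_add, add_mul, mul_add]; abel)
    (by intros; simp only [map_smul, smul_mul_assoc, mul_smul_comm, smul_sub])
    (by intros; simp only [map_add, add_mul, mul_add]; abel)
    (by intros; simp only [map_smul, smul_mul_assoc, mul_smul_comm, smul_sub])

section
variable {𝕜 : Type*} {V : Type*} [Field 𝕜] [AddCommGroup V] [Module 𝕜 V] [Superspace 𝕜 V]

theorem supercomm_hom {i j : ZMod 2} {S T : Module.End 𝕜 V}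
    (hS : S ∈ part (𝕜 := 𝕜) (V := Module.End 𝕜 V) i)
    (hT : T ∈ part (𝕜 := 𝕜) (V := Module.End 𝕜 V) j) :
    supercomm 𝕜 V S T = S * T - superSign 𝕜 i j • (T * S) := by
  simp only [supercomm, LinearMap.mk₂_apply, invol_of_mem hT]
  rcases parity_cases i with rfl | rfl
  · simp [superSign_zero_left, even_of_mem_zero hS, odd_of_mem_zero hS]
  · simp [even_of_mem_one hS, odd_of_mem_one hS]

theorem mul_mem_part {i j : ZMod 2} {S T : Module.End 𝕜 V}
    (hS : S ∈ part (𝕜 := 𝕜) (V := Module.End 𝕜 V) i)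
    (hT : T ∈ part (𝕜 := 𝕜) (V := Module.End 𝕜 V) j) :
    S * T ∈ part (𝕜 := 𝕜) (V := Module.End 𝕜 V) (i + j) := by
  intro k x hx
  rw [add_assoc]
  exact hS _ _ (hT _ _ hx)

theorem supercomm_mem {i j : ZMod 2} {S T : Module.End 𝕜 V}
    (hS : S ∈ part (𝕜 := 𝕜) (V := Module.End 𝕜 V) i)
    (hT : T ∈ part (𝕜 := 𝕜) (V := Module.End 𝕜 V) j) :
    supercomm 𝕜 V S T ∈ part (𝕜 := 𝕜) (V := Module.End 𝕜 V) (i + j) := by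
  rw [supercomm_hom hS hT]
  refine sub_mem (mul_mem_part hS hT) (Submodule.smul_mem _ _ ?_)
  rw [add_comm]
  exact mul_mem_part hT hS

end

/-- The Lie superalgebra of all endomorphisms of a superspace. -/
instance endLie (𝕜 : Type*) (V : Type*) [Field 𝕜] [AddCommGroup V] [Module 𝕜 V]
    [Superspace 𝕜 V] : LieSuperalgebra 𝕜 (Module.End 𝕜 V) where
  br := supercomm 𝕜 V
  br_mem _ _ _ hS _ hT := supercomm_mem hS hT
  br_skew i j S hS T hT := by
    rw [supercomm_hom hS hT, supercomm_hom hT hS]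
    rcases parity_cases i with rfl | rfl <;> rcases parity_cases j with rfl | rfl <;>
      simp only [superSign_zero_left, superSign_zero_right, superSign_one_one, one_smul,
        neg_smul] <;> noncomm_ring
  br_jacobi i j k R hR S hS T hT := by
    rw [supercomm_hom hS hT, supercomm_hom hR hS, supercomm_hom hR hT]
    simp only [map_sub, map_smul, LinearMap.sub_apply, LinearMap.smul_apply]
    rw [supercomm_hom hR (mul_mem_part hS hT), supercomm_hom hR (mul_mem_part hT hS),
      supercomm_hom (mul_mem_part hR hS) hT, supercomm_hom (mul_mem_part hS hR) hT,
      supercomm_hom hS (mul_mem_part hR hT), supercomm_hom hS (mul_mem_part hT hR)]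
    rcases parity_cases i with rfl | rfl <;> rcases parity_cases j with rfl | rfl <;>
      rcases parity_cases k with rfl | rfl <;>
      simp only [superSign_zero_left, superSign_zero_right, superSign_one_one, one_smul,
        neg_smul, zero_add, add_zero, parity_one_add_one] <;> noncomm_ring

end LieSuperalgebra

open LieSuperalgebra

/-- A Lie sub-superalgebra: a graded subspace closed under the bracket. -/
structure LieSubsuperalgebra (𝕜 : Type*) (L : Type*) [Field 𝕜] [AddCommGroup L] [Module 𝕜 L]
    [LieSuperalgebra 𝕜 L] extends Submodule 𝕜 L where
  even_mem' : ∀ x ∈ carrier, even 𝕜 x ∈ carrier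
  odd_mem' : ∀ x ∈ carrier, odd 𝕜 x ∈ carrier
  br_mem' : ∀ x ∈ carrier, ∀ y ∈ carrier, br (𝕜 := 𝕜) x y ∈ carrier

namespace LieSubsuperalgebra

variable {𝕜 : Type*} {L : Type*} [Field 𝕜] [AddCommGroup L] [Module 𝕜 L] [LieSuperalgebra 𝕜 L]

/-- The space of elements of a Lie sub-superalgebra. -/
def Elem (S : LieSubsuperalgebra 𝕜 L) : Type _ := S.toSubmodule

instance (S : LieSubsuperalgebra 𝕜 L) : AddCommGroup S.Elem :=
  inferInstanceAs (AddCommGroup S.toSubmodule)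

instance (S : LieSubsuperalgebra 𝕜 L) : Module 𝕜 S.Elem :=
  inferInstanceAs (Module 𝕜 S.toSubmodule)

/-- The inclusion of a Lie sub-superalgebra. -/
def incl (S : LieSubsuperalgebra 𝕜 L) : S.Elem →ₗ[𝕜] L := S.toSubmodule.subtype

/-- The induced grading. -/
instance superspace (S : LieSubsuperalgebra 𝕜 L) : Superspace 𝕜 S.Elem where
  part i := (part (𝕜 := 𝕜) (V := L) i).comap S.incl
  isCompl := by
    constructor
    · rw [Submodule.disjoint_def]
      intro x h0 h1
      exact Subtype.ext
        (Submodule.disjoint_def.1 (isCompl (𝕜 := 𝕜) (V := L)).disjoint x.1 h0 h1)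
    · rw [codisjoint_iff, eq_top_iff]
      intro x _
      rw [Submodule.mem_sup]
      exact ⟨⟨even 𝕜 x.1, S.even_mem' _ x.2⟩, even_mem 𝕜 x.1, ⟨odd 𝕜 x.1, S.odd_mem' _ x.2⟩,
        odd_mem 𝕜 x.1, Subtype.ext (even_add_odd 𝕜 x.1)⟩

/-- A Lie sub-superalgebra is a Lie superalgebra with the induced grading and bracket. -/
instance lie (S : LieSubsuperalgebra 𝕜 L) : LieSuperalgebra 𝕜 S.Elem where
  br := LinearMap.mk₂ 𝕜
    (fun x y => (⟨br (𝕜 := 𝕜) x.1 y.1, S.br_mem' _ x.2 _ y.2⟩ : S.toSubmodule))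
    (fun x x' y => Subtype.ext (LinearMap.map_add₂ (br (𝕜 := 𝕜)) x.1 x'.1 y.1))
    (fun c x y => Subtype.ext (LinearMap.map_smul₂ (br (𝕜 := 𝕜)) c x.1 y.1))
    (fun x y y' => Subtype.ext (map_add (br (𝕜 := 𝕜) x.1) y.1 y'.1))
    (fun c x y => Subtype.ext (map_smul (br (𝕜 := 𝕜) x.1) c y.1))
  br_mem i j x hx y hy := br_mem (𝕜 := 𝕜) i j x.1 hx y.1 hy
  br_skew i j x hx y hy := Subtype.ext (br_skew (𝕜 := 𝕜) i j x.1 hx y.1 hy)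
  br_jacobi i j k x hx y hy z hz := Subtype.ext (br_jacobi (𝕜 := 𝕜) i j k x.1 hx y.1 hy z.1 hz)

/-- The Lie sub-superalgebra `A₀ ⊕ A₁` with prescribed spaces `A₀`, `A₁` of even and of odd
elements. -/
def ofParts (A : ZMod 2 → Submodule 𝕜 L) (hA : ∀ i, A i ≤ part (𝕜 := 𝕜) (V := L) i)
    (hbr : ∀ i j, ∀ x ∈ A i, ∀ y ∈ A j, br (𝕜 := 𝕜) x y ∈ A (i + j)) :
    LieSubsuperalgebra 𝕜 L where
  toSubmodule := A 0 ⊔ A 1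
  even_mem' := by
    intro x hx
    obtain ⟨y, hy, z, hz, rfl⟩ := Submodule.mem_sup.1 hx
    rw [map_add, even_of_mem_zero (hA 0 hy), even_of_mem_one (hA 1 hz), add_zero]
    exact Submodule.mem_sup_left hy
  odd_mem' := by
    intro x hx
    obtain ⟨y, hy, z, hz, rfl⟩ := Submodule.mem_sup.1 hx
    rw [map_add, odd_of_mem_zero (hA 0 hy), odd_of_mem_one (hA 1 hz), zero_add]
    exact Submodule.mem_sup_right hz
  br_mem' := by
    intro x hx x' hx'
    obtain ⟨y, hy, z, hz, rfl⟩ := Submodule.mem_sup.1 hx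
    obtain ⟨y', hy', z', hz', rfl⟩ := Submodule.mem_sup.1 hx'
    simp only [map_add, LinearMap.add_apply]
    exact add_mem
      (add_mem (Submodule.mem_sup_left (hbr 0 0 _ hy _ hy'))
        (Submodule.mem_sup_right (hbr 1 0 _ hz _ hy')))
      (add_mem (Submodule.mem_sup_right (hbr 0 1 _ hy _ hz'))
        (Submodule.mem_sup_left (hbr 1 1 _ hz _ hz')))

end LieSubsuperalgebra

/-- A homomorphism of Lie superalgebras: an even linear map that respects the brackets. -/
structure LieSuperHom (𝕜 : Type*) (L M : Type*) [Field 𝕜] [AddCommGroup L] [Module 𝕜 L]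
    [LieSuperalgebra 𝕜 L] [AddCommGroup M] [Module 𝕜 M] [LieSuperalgebra 𝕜 M]
    extends L →ₗ[𝕜] M where
  map_part : ∀ i, ∀ x ∈ part (𝕜 := 𝕜) (V := L) i, toFun x ∈ part (𝕜 := 𝕜) (V := M) i
  map_br : ∀ x y, toFun (br (𝕜 := 𝕜) x y) = br (𝕜 := 𝕜) (toFun x) (toFun y)

section Derivations

variable {𝕜 : Type*} {A : Type*} [Field 𝕜] [AddCommGroup A] [Module 𝕜 A] [Superspace 𝕜 A]

/-- The superderivations of parity `i` of a bilinear product `μ` on a superspace: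
`D (x y) = (D x) y + (-1)^{i |x|} x (D y)`. -/
def superDer (μ : A →ₗ[𝕜] A →ₗ[𝕜] A) (i : ZMod 2) : Submodule 𝕜 (Module.End 𝕜 A) where
  carrier := {D | D ∈ part (𝕜 := 𝕜) (V := Module.End 𝕜 A) i ∧
    ∀ j, ∀ x ∈ part (𝕜 := 𝕜) (V := A) j, ∀ y,
      D (μ x y) = μ (D x) y + superSign 𝕜 i j • μ x (D y)}
  add_mem' := by
    rintro D E ⟨hD, hD'⟩ ⟨hE, hE'⟩
    refine ⟨add_mem hD hE, fun j x hx y => ?_⟩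
    simp only [LinearMap.add_apply, map_add, hD' j x hx y, hE' j x hx y, smul_add]
    abel
  zero_mem' := ⟨zero_mem _, by intros; simp⟩
  smul_mem' := by
    rintro c D ⟨hD, hD'⟩
    refine ⟨Submodule.smul_mem _ c hD, fun j x hx y => ?_⟩
    simp only [LinearMap.smul_apply, map_smul, hD' j x hx y, smul_add]
    rw [smul_comm]

theorem superDer_br (μ : A →ₗ[𝕜] A →ₗ[𝕜] A) {i j : ZMod 2} {D E : Module.End 𝕜 A}
    (hD : D ∈ superDer μ i) (hE : E ∈ superDer μ j) :
    br (𝕜 := 𝕜) D E ∈ superDer μ (i + j) := by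
  refine ⟨br_mem (𝕜 := 𝕜) i j D hD.1 E hE.1, fun k x hx y => ?_⟩
  have h : br (𝕜 := 𝕜) D E = D * E - superSign 𝕜 i j • (E * D) := supercomm_hom hD.1 hE.1
  have e1 := hD.2 k x hx
  have e2 := hE.2 k x hx
  have e3 := hD.2 _ _ (hE.1 k x hx)
  have e4 := hE.2 _ _ (hD.1 k x hx)
  simp only [h, LinearMap.sub_apply, LinearMap.smul_apply, Module.End.mul_apply, e1, e2, map_add,
    map_smul, map_sub, e3, e4]
  rcases parity_cases i with rfl | rfl <;> rcases parity_cases j with rfl | rfl <;>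
    rcases parity_cases k with rfl | rfl <;>
    simp only [superSign_zero_left, superSign_zero_right, superSign_one_one, one_smul,
      neg_smul, zero_add, add_zero, parity_one_add_one] <;> abel

end Derivations

/-- The Lie superalgebra of those derivations of `L` that preserve the subalgebra `K`. -/
def derPreserving {𝕜 : Type*} {L : Type*} [Field 𝕜] [AddCommGroup L] [Module 𝕜 L]
    [LieSuperalgebra 𝕜 L] (K : LieSubsuperalgebra 𝕜 L) :
    LieSubsuperalgebra 𝕜 (Module.End 𝕜 L) :=
  LieSubsuperalgebra.ofParts
    (fun i =>
      { carrier := {D | D ∈ superDer (br (𝕜 := 𝕜) (L := L)) i ∧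
          ∀ x ∈ K.toSubmodule, D x ∈ K.toSubmodule}
        add_mem' := fun hD hE => ⟨add_mem hD.1 hE.1, fun x hx => add_mem (hD.2 x hx) (hE.2 x hx)⟩
        zero_mem' := ⟨zero_mem _, fun x _ => zero_mem _⟩
        smul_mem' := fun c D hD =>
          ⟨Submodule.smul_mem _ c hD.1, fun x hx => Submodule.smul_mem _ c (hD.2 x hx)⟩ })
    (fun i D hD => hD.1.1)
    (by
      rintro i j D ⟨hD, hD'⟩ E ⟨hE, hE'⟩
      refine ⟨superDer_br _ hD hE, fun x hx => ?_⟩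
      have h : br (𝕜 := 𝕜) D E = D * E - superSign 𝕜 i j • (E * D) := supercomm_hom hD.1 hE.1
      rw [h]
      exact sub_mem (hD' _ (hE' _ hx)) (Submodule.smul_mem _ _ (hE' _ (hD' _ hx))))

/-! ### Formal functions and formal vector fields -/

section Formal

variable (𝕜 : Type*) (V : Type*) [Field 𝕜] [AddCommGroup V] [Module 𝕜 V] [Superspace 𝕜 V]

/-- Formal functions (formal power series at the origin) on a superspace `V`. A formal function is
given by its Taylor coefficients at `0`: for each `k` a `k`-linear form on `V`, symmetric in the
`ℤ/2`-graded sense, whose value on `u₁, …, u_k` is `f [u₁, …, u_k] = (∂_{u_k} ⋯ ∂_{u₁} f)(0)`.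
In particular `f [] = f(0)`. -/
def formalFunctions : Submodule 𝕜 (List V → 𝕜) where
  carrier := {f |
    (∀ l r u v, f (l ++ (u + v) :: r) = f (l ++ u :: r) + f (l ++ v :: r)) ∧
    (∀ l r (c : 𝕜) u, f (l ++ (c • u) :: r) = c * f (l ++ u :: r)) ∧
    (∀ l r i j, ∀ u ∈ part (𝕜 := 𝕜) (V := V) i, ∀ v ∈ part (𝕜 := 𝕜) (V := V) j,
      f (l ++ u :: v :: r) = superSign 𝕜 i j * f (l ++ v :: u :: r))}
  add_mem' := by
    rintro f g ⟨f1, f2, f3⟩ ⟨g1, g2, g3⟩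
    refine ⟨fun l r u v => ?_, fun l r c u => ?_, fun l r i j u hu v hv => ?_⟩
    · simp only [Pi.add_apply, f1, g1]; ring
    · simp only [Pi.add_apply, f2, g2]; ring
    · simp only [Pi.add_apply, f3 l r i j u hu v hv, g3 l r i j u hu v hv]; ring
  zero_mem' := by simp
  smul_mem' := by
    rintro c f ⟨f1, f2, f3⟩
    refine ⟨fun l r u v => ?_, fun l r c u => ?_, fun l r i j u hu v hv => ?_⟩
    · simp only [Pi.smul_apply, smul_eq_mul, f1]; ring
    · simp only [Pi.smul_apply, smul_eq_mul, f2]; ring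
    · simp only [Pi.smul_apply, smul_eq_mul, f3 l r i j u hu v hv]; ring

/-- The space of formal functions on `V`. -/
def FormalFunction : Type _ := formalFunctions 𝕜 V

instance : AddCommGroup (FormalFunction 𝕜 V) := inferInstanceAs (AddCommGroup (formalFunctions 𝕜 V))

instance : Module 𝕜 (FormalFunction 𝕜 V) := inferInstanceAs (Module 𝕜 (formalFunctions 𝕜 V))

end Formal

namespace FormalFunction

variable {𝕜 : Type*} {V : Type*} [Field 𝕜] [AddCommGroup V] [Module 𝕜 V] [Superspace 𝕜 V]

/-- The derivative along a vector, on Taylor coefficients. -/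
def rawD (u : V) (f : List V → 𝕜) : List V → 𝕜 := fun w => f (u :: w)

/-- The parity involution on Taylor coefficients. -/
def rawInvol (f : List V → 𝕜) : List V → 𝕜 := fun w => f (w.map (invol 𝕜))

/-- The product on Taylor coefficients, determined by `(f g)(0) = f(0) g(0)` and by the Leibniz
rule `∂_u (f g) = (∂_u f) g + (-1)^{|u||f|} f (∂_u g)`. -/
def rawMul : List V → (List V → 𝕜) → (List V → 𝕜) → 𝕜
  | [], f, g => f [] * g []
  | u :: w, f, g => rawMul w (rawD u f) g + rawMul w f (rawD (even 𝕜 u) g) +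
      rawMul w (rawInvol f) (rawD (odd 𝕜 u) g)

theorem rawMul_add_left (w : List V) (f f' g : List V → 𝕜) :
    rawMul w (f + f') g = rawMul w f g + rawMul w f' g := by
  induction w generalizing f f' g with
  | nil => simp [rawMul, add_mul]
  | cons u w ih =>
    have h1 : rawD u (f + f') = rawD u f + rawD u f' := rfl
    have h2 : rawInvol (f + f') = rawInvol f + rawInvol f' := rfl
    simp only [rawMul, h1, h2, ih]; ring

theorem rawMul_smul_left (w : List V) (c : 𝕜) (f g : List V → 𝕜) :
    rawMul w (c • f) g = c * rawMul w f g := by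
  induction w generalizing f g with
  | nil => simp [rawMul, mul_assoc]
  | cons u w ih =>
    have h1 : rawD u (c • f) = c • rawD u f := rfl
    have h2 : rawInvol (c • f) = c • rawInvol f := rfl
    simp only [rawMul, h1, h2, ih]; ring

theorem rawMul_add_right (w : List V) (f g g' : List V → 𝕜) :
    rawMul w f (g + g') = rawMul w f g + rawMul w f g' := by
  induction w generalizing f g g' with
  | nil => simp [rawMul, mul_add]
  | cons u w ih =>
    have h1 : ∀ u, rawD u (g + g') = rawD u g + rawD u g' := fun _ => rfl
    simp only [rawMul, h1, ih]; ring

theorem rawMul_smul_right (w : List V) (c : 𝕜) (f g : List V → 𝕜) :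
    rawMul w f (c • g) = c * rawMul w f g := by
  induction w generalizing f g with
  | nil => simp [rawMul, mul_left_comm]
  | cons u w ih =>
    have h1 : ∀ u, rawD u (c • g) = c • rawD u g := fun _ => rfl
    simp only [rawMul, h1, ih]; ring

theorem rawD_mem (u : V) {f : List V → 𝕜} (hf : f ∈ formalFunctions 𝕜 V) :
    rawD u f ∈ formalFunctions 𝕜 V :=
  ⟨fun l r => hf.1 (u :: l) r, fun l r => hf.2.1 (u :: l) r, fun l r => hf.2.2 (u :: l) r⟩

theorem invol_mem {i : ZMod 2} {u : V} (hu : u ∈ part (𝕜 := 𝕜) (V := V) i) :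
    invol 𝕜 u ∈ part (𝕜 := 𝕜) (V := V) i := by
  rw [invol_of_mem hu]
  exact Submodule.smul_mem _ _ hu

theorem rawInvol_mem {f : List V → 𝕜} (hf : f ∈ formalFunctions 𝕜 V) :
    rawInvol f ∈ formalFunctions 𝕜 V := by
  refine ⟨fun l r u v => ?_, fun l r c u => ?_, fun l r i j u hu v hv => ?_⟩
  · simp only [rawInvol, List.map_append, List.map_cons, map_add, hf.1]
  · simp only [rawInvol, List.map_append, List.map_cons, map_smul, hf.2.1]
  · simp only [rawInvol, List.map_append, List.map_cons]
    exact hf.2.2 _ _ i j _ (invol_mem hu) _ (invol_mem hv)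

theorem rawD_add (u v : V) {f : List V → 𝕜} (hf : f ∈ formalFunctions 𝕜 V) :
    rawD (u + v) f = rawD u f + rawD v f :=
  funext fun w => hf.1 [] w u v

theorem rawD_smul (c : 𝕜) (u : V) {f : List V → 𝕜} (hf : f ∈ formalFunctions 𝕜 V) :
    rawD (c • u) f = c • rawD u f :=
  funext fun w => hf.2.1 [] w c u

theorem rawD_zero {f : List V → 𝕜} (hf : f ∈ formalFunctions 𝕜 V) : rawD (0 : V) f = 0 := by
  simpa using rawD_smul (0 : 𝕜) (0 : V) hf

theorem rawMul_zero (w : List V) (f : List V → 𝕜) : rawMul w f 0 = 0 := by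
  simpa using rawMul_smul_right w (0 : 𝕜) f 0

theorem rawD_swap {i j : ZMod 2} {u v : V} (hu : u ∈ part (𝕜 := 𝕜) (V := V) i)
    (hv : v ∈ part (𝕜 := 𝕜) (V := V) j) {f : List V → 𝕜} (hf : f ∈ formalFunctions 𝕜 V) :
    rawD v (rawD u f) = superSign 𝕜 i j • rawD u (rawD v f) :=
  funext fun w => hf.2.2 [] w i j u hu v hv

theorem rawD_rawInvol {i : ZMod 2} {u : V} (hu : u ∈ part (𝕜 := 𝕜) (V := V) i)
    {f : List V → 𝕜} (hf : f ∈ formalFunctions 𝕜 V) :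
    rawD u (rawInvol f) = superSign 𝕜 1 i • rawInvol (rawD u f) := by
  funext w
  simp only [rawD, rawInvol, List.map_cons, invol_of_mem hu, Pi.smul_apply, smul_eq_mul]
  exact hf.2.1 [] _ _ _

theorem rawInvol_rawInvol (f : List V → 𝕜) : rawInvol (rawInvol f) = f := by
  funext w
  have h : (invol 𝕜 ∘ invol 𝕜 : V → V) = id := funext invol_invol
  simp [rawInvol, h]

theorem rawMul_cons_even {u : V} (hu : u ∈ part (𝕜 := 𝕜) (V := V) 0) (w : List V)
    (f : List V → 𝕜) {g : List V → 𝕜} (hg : g ∈ formalFunctions 𝕜 V) :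
    rawMul (u :: w) f g = rawMul w (rawD u f) g + rawMul w f (rawD u g) := by
  simp only [rawMul, even_of_mem_zero hu, odd_of_mem_zero hu, rawD_zero hg, rawMul_zero, add_zero]

theorem rawMul_cons_odd {u : V} (hu : u ∈ part (𝕜 := 𝕜) (V := V) 1) (w : List V)
    (f : List V → 𝕜) {g : List V → 𝕜} (hg : g ∈ formalFunctions 𝕜 V) :
    rawMul (u :: w) f g = rawMul w (rawD u f) g + rawMul w (rawInvol f) (rawD u g) := by
  simp only [rawMul, even_of_mem_one hu, odd_of_mem_one hu, rawD_zero hg, rawMul_zero, add_zero]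

theorem rawMul_mem {f g : List V → 𝕜} (hf : f ∈ formalFunctions 𝕜 V)
    (hg : g ∈ formalFunctions 𝕜 V) : (fun w => rawMul w f g) ∈ formalFunctions 𝕜 V := by
  refine ⟨fun l r u v => ?_, fun l r c u => ?_, fun l r i j u hu v hv => ?_⟩
  · induction l generalizing f g with
    | nil =>
      simp only [List.nil_append, rawMul, map_add, rawD_add _ _ hf, rawD_add _ _ hg,
        rawMul_add_left, rawMul_add_right]
      ring
    | cons a l ih =>
      simp only [List.cons_append, rawMul] at ih ⊢
      rw [ih (rawD_mem a hf) hg, ih hf (rawD_mem _ hg), ih (rawInvol_mem hf) (rawD_mem _ hg)]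
      ring
  · induction l generalizing f g with
    | nil =>
      simp only [List.nil_append, rawMul, map_smul, rawD_smul _ _ hf, rawD_smul _ _ hg,
        rawMul_smul_left, rawMul_smul_right]
      ring
    | cons a l ih =>
      simp only [List.cons_append, rawMul] at ih ⊢
      rw [ih (rawD_mem a hf) hg, ih hf (rawD_mem _ hg), ih (rawInvol_mem hf) (rawD_mem _ hg)]
      ring
  · induction l generalizing f g with
    | nil =>
      have hfs := rawD_swap hu hv hf
      have hgs := rawD_swap hu hv hg
      have hfu := rawD_rawInvol hu hf
      have hfv := rawD_rawInvol hv hf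
      rcases parity_cases i with rfl | rfl <;> rcases parity_cases j with rfl | rfl
      · simp only [List.nil_append, rawMul_cons_even hu _ _ hg, rawMul_cons_even hv _ _ hg,
          rawMul_cons_even hu _ _ (rawD_mem v hg), rawMul_cons_even hv _ _ (rawD_mem u hg),
          hfs, hgs, superSign_zero_left, one_smul]
        ring
      · simp only [List.nil_append, rawMul_cons_even hu _ _ hg, rawMul_cons_odd hv _ _ hg,
          rawMul_cons_even hu _ _ (rawD_mem v hg), rawMul_cons_odd hv _ _ (rawD_mem u hg),
          hfs, hgs, hfu, superSign_zero_left, superSign_zero_right, one_smul]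
        ring
      · simp only [List.nil_append, rawMul_cons_odd hu _ _ hg, rawMul_cons_even hv _ _ hg,
          rawMul_cons_odd hu _ _ (rawD_mem v hg), rawMul_cons_even hv _ _ (rawD_mem u hg),
          hfs, hgs, hfv, superSign_zero_right, one_smul]
        ring
      · simp only [List.nil_append, rawMul_cons_odd hu _ _ hg, rawMul_cons_odd hv _ _ hg,
          rawMul_cons_odd hu _ _ (rawD_mem v hg), rawMul_cons_odd hv _ _ (rawD_mem u hg),
          hfs, hgs, hfu, hfv, superSign_one_one, rawMul_smul_left, rawMul_smul_right,
          rawInvol_rawInvol]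
        ring
    | cons a l ih =>
      simp only [List.cons_append, rawMul] at ih ⊢
      rw [ih (rawD_mem a hf) hg, ih hf (rawD_mem _ hg), ih (rawInvol_mem hf) (rawD_mem _ hg)]
      ring

/-- The product of formal functions. -/
def mul : FormalFunction 𝕜 V →ₗ[𝕜] FormalFunction 𝕜 V →ₗ[𝕜] FormalFunction 𝕜 V :=
  LinearMap.mk₂ 𝕜 
    (fun f g => (⟨fun w => rawMul w f.1 g.1, rawMul_mem f.2 g.2⟩ : formalFunctions 𝕜 V))
    (fun f f' g => Subtype.ext (funext fun w => rawMul_add_left w f.1 f'.1 g.1))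
    (fun c f g => Subtype.ext (funext fun w => rawMul_smul_left w c f.1 g.1))
    (fun f g g' => Subtype.ext (funext fun w => rawMul_add_right w f.1 g.1 g'.1))
    (fun c f g => Subtype.ext (funext fun w => rawMul_smul_right w c f.1 g.1))

/-- The derivative of formal functions along `u`, i.e. the vector field with constant
coefficients that corresponds to `u`. -/
def pderiv (u : V) : Module.End 𝕜 (FormalFunction 𝕜 V) where
  toFun f := (⟨rawD u f.1, rawD_mem u f.2⟩ : formalFunctions 𝕜 V)
  map_add' _ _ := rfl
  map_smul' _ _ := rfl

/-- The parity of formal functions: `f` has parity `i` if composing it with the parity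
involution of `V` multiplies it by `(-1)^i`. -/
instance superspace [CharZero 𝕜] : Superspace 𝕜 (FormalFunction 𝕜 V) where
  part i :=
    { carrier := {f | rawInvol f.1 = superSign 𝕜 1 i • f.1}
      add_mem' := fun {f g} (hf : _ = _) (hg : _ = _) =>
        show rawInvol f.1 + rawInvol g.1 = superSign 𝕜 1 i • (f.1 + g.1) by
          rw [hf, hg, smul_add]
      zero_mem' := show (0 : List V → 𝕜) = superSign 𝕜 1 i • (0 : List V → 𝕜) by
        rw [smul_zero]
      smul_mem' := fun c f (hf : _ = _) =>
        show c • rawInvol f.1 = superSign 𝕜 1 i • (c • f.1) by rw [hf, smul_comm] }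
  isCompl := by
    constructor
    · rw [Submodule.disjoint_def]
      intro f (h0 : rawInvol f.1 = _) (h1 : rawInvol f.1 = _)
      rw [h0, superSign_zero_right, superSign_one_one, one_smul, neg_smul, one_smul] at h1
      exact Subtype.ext (self_eq_neg.1 h1)
    · rw [codisjoint_iff, eq_top_iff]
      intro f _
      rw [Submodule.mem_sup]
      let g : FormalFunction 𝕜 V := (⟨_, rawInvol_mem f.2⟩ : formalFunctions 𝕜 V)
      refine ⟨(2⁻¹ : 𝕜) • (f + g), ?_, (2⁻¹ : 𝕜) • (f - g), ?_, ?_⟩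
      · change (2⁻¹ : 𝕜) • (rawInvol f.1 + rawInvol (rawInvol f.1)) =
          superSign 𝕜 1 0 • ((2⁻¹ : 𝕜) • (f.1 + rawInvol f.1))
        rw [rawInvol_rawInvol, superSign_zero_right, one_smul, add_comm]
      · change (2⁻¹ : 𝕜) • (rawInvol f.1 - rawInvol (rawInvol f.1)) =
          superSign 𝕜 1 1 • ((2⁻¹ : 𝕜) • (f.1 - rawInvol f.1))
        rw [rawInvol_rawInvol, superSign_one_one, neg_smul, one_smul, ← smul_neg, neg_sub]
      · rw [← smul_add, add_add_sub_cancel, ← two_smul 𝕜, smul_smul,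
          inv_mul_cancel₀ two_ne_zero, one_smul]

theorem pderiv_mem [CharZero 𝕜] {i : ZMod 2} {u : V} (hu : u ∈ part (𝕜 := 𝕜) (V := V) i) :
    pderiv u ∈ superDer (mul (𝕜 := 𝕜) (V := V)) i := by
  refine ⟨fun j f hf => ?_, fun j f (hf : rawInvol f.1 = _) g => Subtype.ext (funext fun w => ?_)⟩
  · have hf : rawInvol f.1 = superSign 𝕜 1 j • f.1 := hf
    change rawInvol (rawD u f.1) = superSign 𝕜 1 (i + j) • rawD u f.1
    have h := rawD_rawInvol hu f.2
    rw [hf] at h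
    have h' : rawD u (superSign 𝕜 1 j • f.1) = superSign 𝕜 1 j • rawD u f.1 := rfl
    rw [h'] at h
    rcases parity_cases i with rfl | rfl <;> rcases parity_cases j with rfl | rfl <;>
      simp only [superSign_zero_right, superSign_one_one, one_smul, neg_smul, zero_add, add_zero,
        parity_one_add_one, neg_inj] at h ⊢
    · exact h.symm
    · exact h.symm
    · exact (neg_eq_iff_eq_neg.2 h).symm
    · exact h.symm
  · change rawMul (u :: w) f.1 g.1 = rawMul w (rawD u f.1) g.1 +
      superSign 𝕜 i j * rawMul w f.1 (rawD u g.1)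
    rcases parity_cases i with rfl | rfl
    · rw [rawMul_cons_even hu _ _ g.2, superSign_zero_left, one_mul]
    · rw [rawMul_cons_odd hu _ _ g.2, hf, rawMul_smul_left]

end FormalFunction

open FormalFunction

/-- The Lie superalgebra `Vect V` of formal vector fields on a superspace `V`: the superderivations
of the algebra of formal functions on `V` that are continuous for coefficientwise convergence (each
Taylor coefficient of `X f` depends on finitely many Taylor coefficients of `f` only; this is
automatic if `V` is finite-dimensional). -/
def formalVect (𝕜 : Type*) (V : Type*) [Field 𝕜] [CharZero 𝕜] [AddCommGroup V] [Module 𝕜 V]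
    [Superspace 𝕜 V] : LieSubsuperalgebra 𝕜 (Module.End 𝕜 (FormalFunction 𝕜 V)) :=
  LieSubsuperalgebra.ofParts
    (fun i => superDer (mul (𝕜 := 𝕜) (V := V)) i ⊓
      { carrier := {X | ∀ w : List V, ∃ W : Finset (List V), ∀ f : FormalFunction 𝕜 V,
          (∀ w' ∈ W, f.1 w' = 0) → (X f).1 w = 0}
        add_mem' := by
          classical
          intro X Y hX hY w
          obtain ⟨A, hA⟩ := hX w
          obtain ⟨B, hB⟩ := hY w
          refine ⟨A ∪ B, fun f hf => ?_⟩
          have a := hA f fun w' h => hf w' (Finset.mem_union_left _ h)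
          have b := hB f fun w' h => hf w' (Finset.mem_union_right _ h)
          change (X f).1 w + (Y f).1 w = 0
          rw [a, b, add_zero]
        zero_mem' := fun w => ⟨∅, fun f _ => rfl⟩
        smul_mem' := by
          intro c X hX w
          obtain ⟨A, hA⟩ := hX w
          refine ⟨A, fun f hf => ?_⟩
          change c * (X f).1 w = 0
          rw [hA f hf, mul_zero] })
    (fun i X hX => hX.1.1)
    (by
      classical
      rintro i j X ⟨hX, hX'⟩ Y ⟨hY, hY'⟩
      refine ⟨superDer_br _ hX hY, ?_⟩
      have comp : ∀ X Y : Module.End 𝕜 (FormalFunction 𝕜 V),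
          (∀ w : List V, ∃ W : Finset (List V), ∀ f : FormalFunction 𝕜 V,
            (∀ w' ∈ W, f.1 w' = 0) → (X f).1 w = 0) →
          (∀ w : List V, ∃ W : Finset (List V), ∀ f : FormalFunction 𝕜 V,
            (∀ w' ∈ W, f.1 w' = 0) → (Y f).1 w = 0) →
          ∀ w : List V, ∃ W : Finset (List V), ∀ f : FormalFunction 𝕜 V,
            (∀ w' ∈ W, f.1 w' = 0) → ((X * Y) f).1 w = 0 := by
        intro X Y hX hY w
        obtain ⟨A, hA⟩ := hX w
        choose B hB using hY
        exact ⟨A.biUnion B, fun f hf => hA _ fun w' hw' => hB w' f fun w'' hw'' =>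
          hf w'' (Finset.mem_biUnion.2 ⟨w', hw', hw''⟩)⟩
      have h : br (𝕜 := 𝕜) X Y = X * Y - superSign 𝕜 i j • (Y * X) := supercomm_hom hX.1 hY.1
      rw [h]
      exact sub_mem (comp X Y hX' hY') (Submodule.smul_mem _ _ (comp Y X hY' hX')))

namespace formalVect

variable {𝕜 : Type*} {V : Type*} [Field 𝕜] [CharZero 𝕜] [AddCommGroup V] [Module 𝕜 V]
  [Superspace 𝕜 V]

/-- A vector `u ∈ V` as a formal vector field with constant coefficients. -/
def const (u : V) : (formalVect 𝕜 V).Elem :=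
  (⟨pderiv u, by
    have hc : ∀ u : V, ∀ w : List V, ∃ W : Finset (List V), ∀ f : FormalFunction 𝕜 V,
        (∀ w' ∈ W, f.1 w' = 0) → (pderiv u f).1 w = 0 :=
      fun u w => ⟨{u :: w}, fun f hf => hf _ (Finset.mem_singleton_self _)⟩
    have hu : pderiv u = pderiv (𝕜 := 𝕜) (even 𝕜 u) + pderiv (odd 𝕜 u) := by
      refine LinearMap.ext fun f => Subtype.ext ?_
      have h := rawD_add (even 𝕜 u) (odd 𝕜 u) f.2
      rw [even_add_odd] at h
      exact h
    rw [hu]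
    exact add_mem (Submodule.mem_sup_left ⟨pderiv_mem (even_mem 𝕜 u), hc _⟩)
      (Submodule.mem_sup_right ⟨pderiv_mem (odd_mem 𝕜 u), hc _⟩)⟩ :
      (formalVect 𝕜 V).toSubmodule)

/-- `X(0) = v`: the formal vector field `X` has the value `v ∈ V` at the origin, i.e.
`(X f)(0) = (∂_v f)(0)` for all formal functions `f`. -/
def HasValueAtZero (X : (formalVect 𝕜 V).Elem) (v : V) : Prop :=
  ∀ f : FormalFunction 𝕜 V, ((formalVect 𝕜 V).incl X f).1 [] = f.1 [v]

end formalVect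

/-- The iterated bracket `[…[[x, y₁], y₂], …, y_k]` in a Lie superalgebra. -/
def iterBr (𝕜 : Type*) {L : Type*} [Field 𝕜] [AddCommGroup L] [Module 𝕜 L] [LieSuperalgebra 𝕜 L]
    (x : L) (l : List L) : L :=
  l.foldl (fun z y => br (𝕜 := 𝕜) z y) x

section DerivedBrackets

variable {𝕜 : Type*} {L : Type*} [Field 𝕜] [AddCommGroup L] [Module 𝕜 L] [LieSuperalgebra 𝕜 L]

/-- The higher derived bracket `{a, a₂, …, a_k}_D = P[…[[D a, a₂], a₃], …, a_k]` on `V`, where `P` is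
the projector on `V` parallel to `K`; here `l = [a₂, …, a_k]`, and `k ≥ 1` is arbitrary. -/
def derivedBracket (K V : LieSubsuperalgebra 𝕜 L) (h : IsCompl V.toSubmodule K.toSubmodule)
    (D : Module.End 𝕜 L) (a : V.Elem) (l : List V.Elem) : V.Elem :=
  V.toSubmodule.projectionOnto K.toSubmodule h (iterBr 𝕜 (D (V.incl a)) (l.map V.incl))

/-- The formal vector field `Q` on `V` encodes the higher derived brackets of `D`: its value at the
origin (the `0`-ary bracket) is zero, and
`[…[[Q, a₁], a₂], …, a_k](0) = {a₁, a₂, …, a_k}_D` for all `k ≥ 1` and `a₁, …, a_k ∈ V`. -/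
def EncodesDerivedBrackets [CharZero 𝕜] (K V : LieSubsuperalgebra 𝕜 L)
    (h : IsCompl V.toSubmodule K.toSubmodule) (D : (derPreserving K).Elem)
    (Q : (formalVect 𝕜 V.Elem).Elem) : Prop :=
  formalVect.HasValueAtZero Q 0 ∧
  ∀ (a : V.Elem) (l : List V.Elem),
    formalVect.HasValueAtZero (iterBr 𝕜 Q ((a :: l).map formalVect.const))
      (derivedBracket K V h ((derPreserving K).incl D) a l)

end DerivedBrackets

end

open Superspace LieSuperalgebra FormalFunction

noncomputable section

/-! ### Sign rules. -/

section Sign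

variable (𝕜 : Type*) [Field 𝕜]

/-! Write `∂_u` for a constant vector field. Up to signs, `∂_u (A f) = A (∂_u f) - [A, ∂_u] f` for
every operator `A` on formal functions, so `A` is zero as soon as all its iterated brackets with
constant fields vanish at the origin (`eq_zero_of_mem`, `eq_zero_of_mem_generators`). This gives the
uniqueness of `Q_D`. It also reduces an identity between operators to two checks: it holds at the
origin, and bracketing with `∂_u` leads back to identities of the same family.

For existence, the same formula, read as a recursion on Taylor coefficients, builds an operator
`toEnd c` from any graded symmetric family `c` of multilinear maps with values in `V`. Its Leibniz
rule (`br_toEnd_mul`) follows from the criterion.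

For the homomorphism property, attach to every `x` in `L` an auxiliary field `X_x` (`inner`) with
coefficients `P[…[x, a₁], …, a_k]`, besides `Q_D` (`outer`). Then `[X_x, ∂_u] = X_{[x,u]}` and
`[Q_D, ∂_u] = X_{Du}`. The relations `[X_x, X_y] = X_{[x,y]}` (`br_toEnd_inner`), `[Q_D, X_x] =
X_{Dx}` (`br_toEnd_outer_inner`) and `[Q_D, Q_E] = Q_{[D,E]}` (`br_toEnd_outer`) are proved in this
order, since by the Jacobi identity the bracket of each with `∂_u` involves only itself and its
predecessor. At the origin the first says `P[x, y] = P[x, Py] + P[Px, y]`, which holds because `K`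
is a subalgebra and `V` is Abelian (`proj_br`); the second says `P D x = P D P x`, which holds
because `D` preserves `K`; in the third both sides vanish. -/

theorem superSign_comm (i j : ZMod 2) : superSign 𝕜 i j = superSign 𝕜 j i := by
  simp only [superSign, and_comm]

theorem superSign_mul_self (i j : ZMod 2) : superSign 𝕜 i j * superSign 𝕜 i j = 1 := by
  unfold superSign; split_ifs <;> simp

theorem superSign_add_left (i j k : ZMod 2) :
    superSign 𝕜 (i + j) k = superSign 𝕜 i k * superSign 𝕜 j k := by
  rcases parity_cases i with rfl | rfl <;> rcases parity_cases j with rfl | rfl <;>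
    rcases parity_cases k with rfl | rfl <;>
    simp [superSign_zero_left, superSign_zero_right, superSign_one_one, parity_one_add_one]

theorem superSign_add_right (i j k : ZMod 2) :
    superSign 𝕜 i (j + k) = superSign 𝕜 i j * superSign 𝕜 i k := by
  rw [superSign_comm, superSign_add_left, superSign_comm 𝕜 j, superSign_comm 𝕜 k]

end Sign

/-! ### The parity involution and supercommutators. -/

namespace Superspace

variable {𝕜 : Type*} {V : Type*} [Field 𝕜] [AddCommGroup V] [Module 𝕜 V] [Superspace 𝕜 V]

theorem invol_even (x : V) : invol 𝕜 (even 𝕜 x) = even 𝕜 x := by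
  rw [invol_of_mem (even_mem 𝕜 x), superSign_zero_right, one_smul]

theorem invol_odd (x : V) : invol 𝕜 (odd 𝕜 x) = -odd 𝕜 x := by
  rw [invol_of_mem (odd_mem 𝕜 x), superSign_one_one, neg_smul, one_smul]

theorem even_invol (x : V) : even 𝕜 (invol 𝕜 x) = even 𝕜 x := by
  rw [invol, LinearMap.sub_apply, map_sub, even_of_mem_zero (even_mem 𝕜 x),
    even_of_mem_one (odd_mem 𝕜 x), sub_zero]

theorem odd_invol (x : V) : odd 𝕜 (invol 𝕜 x) = -odd 𝕜 x := by
  rw [invol, LinearMap.sub_apply, map_sub, odd_of_mem_one (odd_mem 𝕜 x),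
    odd_of_mem_zero (even_mem 𝕜 x), zero_sub]

/-- The component of the wrong parity equals its own negative, hence is zero as `2` is invertible.
Parities can thus be tested by conjugation with the involution. -/
theorem mem_part_of_invol [CharZero 𝕜] {i : ZMod 2} {x : V}
    (h : invol 𝕜 x = superSign 𝕜 1 i • x) : x ∈ part (𝕜 := 𝕜) (V := V) i := by
  have hx := even_add_odd 𝕜 x
  have h2 : ∀ y : V, y = -y → y = 0 := fun y hy => by
    have : (2 : 𝕜) • y = 0 := by rw [two_smul]; nth_rw 1 [hy]; simp
    exact (smul_eq_zero.1 this).resolve_left two_ne_zero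
  rcases parity_cases i with rfl | rfl
  · rw [superSign_zero_right, one_smul] at h
    have ho := congrArg (odd 𝕜) h
    rw [odd_invol] at ho
    rw [h2 _ ho.symm, add_zero] at hx
    exact hx ▸ even_mem 𝕜 x
  · rw [superSign_one_one, neg_smul, one_smul] at h
    have ho := congrArg (even 𝕜) h
    rw [even_invol, map_neg] at ho
    rw [h2 _ ho, zero_add] at hx
    exact hx ▸ odd_mem 𝕜 x

/-- The parity involution of endomorphisms is the conjugation by the parity involution. -/
theorem invol_end_apply (A : Module.End 𝕜 V) (x : V) :
    invol 𝕜 A x = invol 𝕜 (A (invol 𝕜 x)) := by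
  refine hom_induction (𝕜 := 𝕜)
    (p := fun A : Module.End 𝕜 V => ∀ x, invol 𝕜 A x = invol 𝕜 (A (invol 𝕜 x))) A
    (fun A B hA hB x => by simp [hA, hB]) (fun i A hA x => ?_) x
  refine hom_induction (𝕜 := 𝕜) (p := fun x => invol 𝕜 A x = invol 𝕜 (A (invol 𝕜 x))) x
    (fun x y hx hy => by simp [hx, hy]) (fun j x hx => ?_)
  rw [invol_of_mem hA, invol_of_mem hx, map_smul, map_smul, invol_of_mem (hA j x hx),
    superSign_add_right, smul_smul, mul_left_comm, superSign_mul_self, mul_one]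
  rfl

end Superspace

namespace LieSuperalgebra

variable {𝕜 : Type*} {V : Type*} [Field 𝕜] [AddCommGroup V] [Module 𝕜 V] [Superspace 𝕜 V]

theorem br_of_even (A : Module.End 𝕜 V) {T : Module.End 𝕜 V}
    (hT : T ∈ part (𝕜 := 𝕜) (V := Module.End 𝕜 V) 0) :
    br (𝕜 := 𝕜) A T = A * T - T * A := by
  change A * T - T * even 𝕜 A - invol 𝕜 T * odd 𝕜 A = _
  rw [invol_of_mem hT, superSign_zero_right, one_smul, sub_sub, ← mul_add, even_add_odd]

/-- Only `T` has to be homogeneous: the sign `(-1)^{|A|}` becomes the parity involution of `A`, so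
that inhomogeneous operators can be handled without splitting them. -/
theorem br_of_odd (A : Module.End 𝕜 V) {T : Module.End 𝕜 V}
    (hT : T ∈ part (𝕜 := 𝕜) (V := Module.End 𝕜 V) 1) :
    br (𝕜 := 𝕜) A T = A * T - T * invol 𝕜 A := by
  change A * T - T * even 𝕜 A - invol 𝕜 T * odd 𝕜 A = _
  rw [invol_of_mem hT, superSign_one_one, neg_smul, one_smul, invol, LinearMap.sub_apply,
    neg_mul, mul_sub, sub_sub, ← sub_eq_add_neg]

theorem br_apply_of_mem {i j : ZMod 2} {S T : Module.End 𝕜 V}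
    (hS : S ∈ part (𝕜 := 𝕜) (V := Module.End 𝕜 V) i)
    (hT : T ∈ part (𝕜 := 𝕜) (V := Module.End 𝕜 V) j) (x : V) :
    br (𝕜 := 𝕜) S T x = S (T x) - superSign 𝕜 i j • T (S x) :=
  congrArg (fun A : Module.End 𝕜 V => A x) (supercomm_hom hS hT)

/-- The Jacobi identity as the rule for the bracket of `[x, y]` with a third element. -/
theorem br_br {L : Type*} [AddCommGroup L] [Module 𝕜 L] [LieSuperalgebra 𝕜 L] {i j k : ZMod 2}
    {x y z : L} (hx : x ∈ part (𝕜 := 𝕜) (V := L) i) (hy : y ∈ part (𝕜 := 𝕜) (V := L) j)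
    (hz : z ∈ part (𝕜 := 𝕜) (V := L) k) :
    br (𝕜 := 𝕜) (br (𝕜 := 𝕜) x y) z =
      br (𝕜 := 𝕜) x (br (𝕜 := 𝕜) y z) - superSign 𝕜 i j • br (𝕜 := 𝕜) y (br (𝕜 := 𝕜) x z) :=
  eq_sub_of_add_eq (br_jacobi i j k x hx y hy z hz).symm

end LieSuperalgebra

/-! ### Operators are determined by their brackets with constant fields. -/

namespace FormalFunction

variable {𝕜 : Type*} {V : Type*} [Field 𝕜] [AddCommGroup V] [Module 𝕜 V] [Superspace 𝕜 V]

theorem ext_coeff {f g : FormalFunction 𝕜 V} (h : ∀ w, f.1 w = g.1 w) : f = g :=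
  Subtype.ext (funext h)

theorem pderiv_add (u v : V) : pderiv (𝕜 := 𝕜) (u + v) = pderiv u + pderiv v :=
  LinearMap.ext fun f => Subtype.ext (rawD_add u v f.2)

variable [CharZero 𝕜]

theorem invol_val (f : FormalFunction 𝕜 V) : (invol 𝕜 f).1 = rawInvol f.1 := by
  refine hom_induction (𝕜 := 𝕜) (p := fun f => (invol 𝕜 f).1 = rawInvol f.1) f
    (fun f g hf hg => ?_) (fun i f hf => ?_)
  · rw [map_add]
    exact congrArg₂ (· + ·) hf hg
  · rw [invol_of_mem hf]
    exact hf.symm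

/-- An operator on formal functions vanishes if it belongs to a space of operators that is closed
under the brackets with constant vector fields and consists of operators that vanish at `0`. -/
theorem eq_zero_of_mem (N : Submodule 𝕜 (Module.End 𝕜 (FormalFunction 𝕜 V)))
    (h0 : ∀ A ∈ N, ∀ f, (A f).1 [] = 0)
    (h1 : ∀ A ∈ N, ∀ k, ∀ u ∈ part (𝕜 := 𝕜) (V := V) k, br (𝕜 := 𝕜) A (pderiv u) ∈ N)
    {A : Module.End 𝕜 (FormalFunction 𝕜 V)} (hA : A ∈ N) : A = 0 := by
  refine LinearMap.ext fun f => ext_coeff fun w => ?_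
  change (A f).1 w = 0
  induction hn : w.length generalizing w A f with
  | zero => exact List.length_eq_zero_iff.1 hn ▸ h0 A hA f
  | succ n ih =>
    obtain ⟨u, w, rfl⟩ := List.exists_cons_of_length_eq_add_one hn
    have hw : w.length = n := by simpa using hn
    -- The coefficient at `u :: w` is that of `∂_u (A f) = A (∂_u f) - [A, ∂_u] f` at the shorter
    -- word `w`.
    have hev : (A f).1 (even 𝕜 u :: w) = 0 := by
      have h := ih (h1 A hA 0 _ (even_mem 𝕜 u)) f w hw
      rw [br_of_even A (pderiv_mem (even_mem 𝕜 u)).1] at h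
      have h' : (A (pderiv (even 𝕜 u) f)).1 w - (A f).1 (even 𝕜 u :: w) = 0 := h
      rwa [ih hA _ _ hw, zero_sub, neg_eq_zero] at h'
    -- For odd `u` the bracket formula contains `invol A`, about which `N` says nothing. Evaluating
    -- at the involuted function, vector and word turns this term back into a coefficient of `A f`.
    have hod : (A f).1 (odd 𝕜 u :: w) = 0 := by
      have hv := FormalFunction.invol_mem (odd_mem 𝕜 u)
      have hw' : (w.map (invol 𝕜)).length = n := by simpa using hw
      have h := ih (h1 A hA 1 _ hv) (invol 𝕜 f) _ hw'
      rw [br_of_odd A (pderiv_mem hv).1] at h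
      have h' : (A (pderiv (invol 𝕜 (odd 𝕜 u)) (invol 𝕜 f))).1 (w.map (invol 𝕜)) -
          (invol 𝕜 A (invol 𝕜 f)).1 ((odd 𝕜 u :: w).map (invol 𝕜)) = 0 := h
      rw [ih hA _ _ hw', zero_sub, neg_eq_zero, invol_end_apply, invol_invol, invol_val] at h'
      exact (congrFun (rawInvol_rawInvol (A f).1) _).symm.trans h'
    have h := (A f).2.1 [] w (even 𝕜 u) (odd 𝕜 u)
    rw [even_add_odd] at h
    exact h.trans (by rw [List.nil_append, List.nil_append, hev, hod, add_zero])

/-- A version of `eq_zero_of_mem` for the span of a set of operators. -/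
theorem eq_zero_of_mem_generators (G : Set (Module.End 𝕜 (FormalFunction 𝕜 V)))
    (h0 : ∀ A ∈ G, ∀ f, (A f).1 [] = 0)
    (h1 : ∀ A ∈ G, ∀ k, ∀ u ∈ part (𝕜 := 𝕜) (V := V) k,
      br (𝕜 := 𝕜) A (pderiv u) ∈ Submodule.span 𝕜 G)
    {A : Module.End 𝕜 (FormalFunction 𝕜 V)} (hA : A ∈ G) : A = 0 := by
  refine eq_zero_of_mem (Submodule.span 𝕜 G) (fun A hA => ?_) (fun A hA k u hu => ?_)
    (Submodule.subset_span hA)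
  · induction hA using Submodule.span_induction with
    | mem A h => exact h0 A h
    | zero => exact fun _ => rfl
    | add A B _ _ hA hB =>
      exact fun g => (congrArg₂ (· + ·) (hA g) (hB g)).trans (add_zero 0)
    | smul a A _ hA => exact fun g => (congrArg (a * ·) (hA g)).trans (mul_zero a)
  · induction hA using Submodule.span_induction with
    | mem A h => exact h1 A h k u hu
    | zero => simp
    | add A B _ _ hA hB => rw [map_add]; exact add_mem hA hB
    | smul a A _ hA => rw [map_smul]; exact Submodule.smul_mem _ a hA

end FormalFunction

/-! ### Formal maps and the operators they define. -/

/-- Formal maps from a superspace `V` to itself, given by their Taylor coefficients at `0`: for each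
`k` a `k`-linear map, symmetric in the `ℤ/2`-graded sense. -/
def formalMaps (𝕜 : Type*) (V : Type*) [Field 𝕜] [AddCommGroup V] [Module 𝕜 V] [Superspace 𝕜 V] :
    Submodule 𝕜 (List V → V) where
  carrier := {c |
    (∀ l r u v, c (l ++ (u + v) :: r) = c (l ++ u :: r) + c (l ++ v :: r)) ∧
    (∀ l r (a : 𝕜) u, c (l ++ (a • u) :: r) = a • c (l ++ u :: r)) ∧
    (∀ l r i j, ∀ u ∈ part (𝕜 := 𝕜) (V := V) i, ∀ v ∈ part (𝕜 := 𝕜) (V := V) j,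
      c (l ++ u :: v :: r) = superSign 𝕜 i j • c (l ++ v :: u :: r))}
  add_mem' := by
    rintro f g ⟨f1, f2, f3⟩ ⟨g1, g2, g3⟩
    refine ⟨fun l r u v => ?_, fun l r c u => ?_, fun l r i j u hu v hv => ?_⟩
    · simp only [Pi.add_apply, f1, g1]; abel
    · simp only [Pi.add_apply, f2, g2, smul_add]
    · simp only [Pi.add_apply, f3 l r i j u hu v hv, g3 l r i j u hu v hv, smul_add]
  zero_mem' := by simp
  smul_mem' := by
    rintro a f ⟨f1, f2, f3⟩
    refine ⟨fun l r u v => ?_, fun l r c u => ?_, fun l r i j u hu v hv => ?_⟩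
    · simp only [Pi.smul_apply, f1, smul_add]
    · simp only [Pi.smul_apply, f2, smul_comm a c]
    · simp only [Pi.smul_apply, f3 l r i j u hu v hv, smul_comm a]

namespace FormalMap

section Raw

variable {𝕜 : Type*} {V : Type*} [Field 𝕜] [AddCommGroup V] [Module 𝕜 V] [Superspace 𝕜 V]

/-- The derivative along a vector, on Taylor coefficients. -/
def rawShift (u : V) (c : List V → V) : List V → V := fun w => c (u :: w)

variable (𝕜) in
/-- The conjugation with the parity involution, on Taylor coefficients. -/
def rawConj (c : List V → V) : List V → V := fun w => invol 𝕜 (c (w.map (invol 𝕜)))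

/-- The Taylor coefficients of the derivative of a formal function along the vector field `X` with
Taylor coefficients `c`, determined by `(X f)(0) = (∂_{c(0)} f)(0)` and by the rule
`∂_u X f = (-1)^{|u||X|} (X ∂_u f - [X, ∂_u] f)`. -/
def rawVect : List V → (List V → V) → (List V → 𝕜) → 𝕜
  | [], c, f => f [c []]
  | u :: w, c, f =>
      (rawVect w c (rawD (even 𝕜 u) f) - rawVect w (rawShift (even 𝕜 u) c) f) +
      (rawVect w (rawConj 𝕜 c) (rawD (odd 𝕜 u) f) -
        rawVect w (rawShift (odd 𝕜 u) (rawConj 𝕜 c)) f)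

theorem rawShift_mem (u : V) {c : List V → V} (hc : c ∈ formalMaps 𝕜 V) :
    rawShift u c ∈ formalMaps 𝕜 V :=
  ⟨fun l r => hc.1 (u :: l) r, fun l r => hc.2.1 (u :: l) r, fun l r => hc.2.2 (u :: l) r⟩

theorem rawConj_mem {c : List V → V} (hc : c ∈ formalMaps 𝕜 V) :
    rawConj 𝕜 c ∈ formalMaps 𝕜 V := by
  refine ⟨fun l r u v => ?_, fun l r a u => ?_, fun l r i j u hu v hv => ?_⟩
  · simp only [rawConj, List.map_append, List.map_cons, map_add, hc.1]
  · simp only [rawConj, List.map_append, List.map_cons, map_smul, hc.2.1]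
  · simp only [rawConj, List.map_append, List.map_cons, ← map_smul]
    rw [hc.2.2 _ _ i j _ (FormalFunction.invol_mem hu) _ (FormalFunction.invol_mem hv)]

theorem rawConj_rawConj (c : List V → V) : rawConj 𝕜 (rawConj 𝕜 c) = c := by
  funext w
  have h : (invol 𝕜 ∘ invol 𝕜 : V → V) = id := funext invol_invol
  simp [rawConj, h, invol_invol]

theorem rawConj_add (c d : List V → V) : rawConj 𝕜 (c + d) = rawConj 𝕜 c + rawConj 𝕜 d :=
  funext fun _ => map_add _ _ _

theorem rawConj_smul (a : 𝕜) (c : List V → V) : rawConj 𝕜 (a • c) = a • rawConj 𝕜 c :=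
  funext fun _ => map_smul _ _ _

theorem rawShift_add (u v : V) {c : List V → V} (hc : c ∈ formalMaps 𝕜 V) :
    rawShift (u + v) c = rawShift u c + rawShift v c :=
  funext fun w => hc.1 [] w u v

theorem rawShift_smul (a : 𝕜) (u : V) {c : List V → V} (hc : c ∈ formalMaps 𝕜 V) :
    rawShift (a • u) c = a • rawShift u c :=
  funext fun w => hc.2.1 [] w a u

theorem rawShift_zero {c : List V → V} (hc : c ∈ formalMaps 𝕜 V) : rawShift (0 : V) c = 0 := by
  simpa using rawShift_smul (0 : 𝕜) (0 : V) hc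

theorem rawShift_swap {i j : ZMod 2} {u v : V} (hu : u ∈ part (𝕜 := 𝕜) (V := V) i)
    (hv : v ∈ part (𝕜 := 𝕜) (V := V) j) {c : List V → V} (hc : c ∈ formalMaps 𝕜 V) :
    rawShift v (rawShift u c) = superSign 𝕜 i j • rawShift u (rawShift v c) :=
  funext fun w => hc.2.2 [] w i j u hu v hv

theorem rawShift_rawConj {i : ZMod 2} {u : V} (hu : u ∈ part (𝕜 := 𝕜) (V := V) i)
    {c : List V → V} (hc : c ∈ formalMaps 𝕜 V) :
    rawShift u (rawConj 𝕜 c) = superSign 𝕜 1 i • rawConj 𝕜 (rawShift u c) := by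
  change rawConj 𝕜 (rawShift (invol 𝕜 u) c) = _
  rw [invol_of_mem hu, rawShift_smul _ _ hc, rawConj_smul]

theorem rawVect_add_right (w : List V) (c : List V → V) (f g : List V → 𝕜) :
    rawVect w c (f + g) = rawVect w c f + rawVect w c g := by
  induction w generalizing c f g with
  | nil => rfl
  | cons u w ih =>
    have h : ∀ u, rawD u (f + g) = rawD u f + rawD u g := fun _ => rfl
    simp only [rawVect, h, ih]; ring

theorem rawVect_smul_right (w : List V) (a : 𝕜) (c : List V → V) (f : List V → 𝕜) :
    rawVect w c (a • f) = a * rawVect w c f := by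
  induction w generalizing c f with
  | nil => rfl
  | cons u w ih =>
    have h : ∀ u, rawD u (a • f) = a • rawD u f := fun _ => rfl
    simp only [rawVect, h, ih]; ring

theorem rawVect_zero_right (w : List V) (c : List V → V) : rawVect w c (0 : List V → 𝕜) = 0 := by
  simpa using rawVect_smul_right w (0 : 𝕜) c 0

theorem rawVect_add_left (w : List V) (c d : List V → V) {f : List V → 𝕜}
    (hf : f ∈ formalFunctions 𝕜 V) : rawVect w (c + d) f = rawVect w c f + rawVect w d f := by
  induction w generalizing c d f with
  | nil => exact hf.1 [] [] _ _
  | cons u w ih =>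
    have h : ∀ (u : V) c d, rawShift u (c + d) = rawShift u c + rawShift u d := fun _ _ _ => rfl
    simp only [rawVect, h, rawConj_add, ih _ _ hf, ih _ _ (rawD_mem _ hf)]; ring

theorem rawVect_smul_left (w : List V) (a : 𝕜) (c : List V → V) {f : List V → 𝕜}
    (hf : f ∈ formalFunctions 𝕜 V) : rawVect w (a • c) f = a * rawVect w c f := by
  induction w generalizing c f with
  | nil => exact hf.2.1 [] [] _ _
  | cons u w ih =>
    have h : ∀ (u : V) c, rawShift u (a • c) = a • rawShift u c := fun _ _ => rfl
    simp only [rawVect, h, rawConj_smul, ih _ hf, ih _ (rawD_mem _ hf)]; ring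

theorem rawVect_zero_left (w : List V) {f : List V → 𝕜} (hf : f ∈ formalFunctions 𝕜 V) :
    rawVect w 0 f = 0 := by
  simpa using rawVect_smul_left w (0 : 𝕜) 0 hf

theorem rawVect_cons_even {u : V} (hu : u ∈ part (𝕜 := 𝕜) (V := V) 0) (w : List V)
    {c : List V → V} (hc : c ∈ formalMaps 𝕜 V) {f : List V → 𝕜} (hf : f ∈ formalFunctions 𝕜 V) :
    rawVect (u :: w) c f = rawVect w c (rawD u f) - rawVect w (rawShift u c) f := by
  simp only [rawVect, even_of_mem_zero hu, odd_of_mem_zero hu, rawD_zero hf,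
    rawShift_zero (rawConj_mem hc), rawVect_zero_left w hf, rawVect_zero_right, sub_zero, add_zero]

theorem rawVect_cons_odd {u : V} (hu : u ∈ part (𝕜 := 𝕜) (V := V) 1) (w : List V)
    {c : List V → V} (hc : c ∈ formalMaps 𝕜 V) {f : List V → 𝕜} (hf : f ∈ formalFunctions 𝕜 V) :
    rawVect (u :: w) c f =
      rawVect w (rawConj 𝕜 c) (rawD u f) - rawVect w (rawShift u (rawConj 𝕜 c)) f := by
  simp only [rawVect, even_of_mem_one hu, odd_of_mem_one hu, rawD_zero hf,
    rawShift_zero hc, rawVect_zero_left w hf, rawVect_zero_right, sub_zero, zero_add]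

/-- The recursion removes the first vector of the word, so each condition reduces by induction on
`l` to the head of the word. There the symmetry follows by expanding twice and using the symmetry of
`c` and of `f`. -/
theorem rawVect_mem {c : List V → V} (hc : c ∈ formalMaps 𝕜 V) {f : List V → 𝕜}
    (hf : f ∈ formalFunctions 𝕜 V) : (fun w => rawVect w c f) ∈ formalFunctions 𝕜 V := by
  refine ⟨fun l r u v => ?_, fun l r a u => ?_, fun l r i j u hu v hv => ?_⟩
  · induction l generalizing c f with
    | nil =>
      simp only [List.nil_append, rawVect, map_add, rawD_add _ _ hf, rawShift_add _ _ hc,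
        rawShift_add _ _ (rawConj_mem hc), rawVect_add_left _ _ _ hf, rawVect_add_right]
      ring
    | cons b l ih =>
      simp only [List.cons_append, rawVect] at ih ⊢
      rw [ih hc (rawD_mem _ hf), ih (rawShift_mem _ hc) hf, ih (rawConj_mem hc) (rawD_mem _ hf),
        ih (rawShift_mem _ (rawConj_mem hc)) hf]
      ring
  · induction l generalizing c f with
    | nil =>
      simp only [List.nil_append, rawVect, map_smul, rawD_smul _ _ hf, rawShift_smul _ _ hc,
        rawShift_smul _ _ (rawConj_mem hc), rawVect_smul_left _ _ _ hf, rawVect_smul_right]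
      ring
    | cons b l ih =>
      simp only [List.cons_append, rawVect] at ih ⊢
      rw [ih hc (rawD_mem _ hf), ih (rawShift_mem _ hc) hf, ih (rawConj_mem hc) (rawD_mem _ hf),
        ih (rawShift_mem _ (rawConj_mem hc)) hf]
      ring
  · induction l generalizing c f with
    | nil =>
      have hfs := rawD_swap hu hv hf
      have hcs := rawShift_swap hu hv hc
      have hcs' := rawShift_swap hu hv (rawConj_mem hc)
      have hcu := rawShift_rawConj hu hc
      have hcv := rawShift_rawConj hv hc
      have hc' := rawConj_mem hc
      have hfu := rawD_mem u hf
      have hfv := rawD_mem v hf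
      rcases parity_cases i with rfl | rfl <;> rcases parity_cases j with rfl | rfl
      · simp only [List.nil_append, rawVect_cons_even hu _ hc hf, rawVect_cons_even hv _ hc hf,
          rawVect_cons_even hu _ hc hfv, rawVect_cons_even hv _ hc hfu,
          rawVect_cons_even hu _ (rawShift_mem v hc) hf,
          rawVect_cons_even hv _ (rawShift_mem u hc) hf, hfs, hcs, superSign_zero_left, one_smul]
        ring
      · simp only [List.nil_append, rawVect_cons_even hu _ hc hf, rawVect_cons_odd hv _ hc hf,
          rawVect_cons_even hu _ hc' hfv, rawVect_cons_odd hv _ hc hfu,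
          rawVect_cons_even hu _ (rawShift_mem v hc') hf,
          rawVect_cons_odd hv _ (rawShift_mem u hc) hf, hfs, superSign_zero_left,
          superSign_zero_right, one_smul] at hcs' hcu ⊢
        rw [← hcu, hcs']
        ring
      · simp only [List.nil_append, rawVect_cons_odd hu _ hc hf, rawVect_cons_even hv _ hc hf,
          rawVect_cons_odd hu _ hc hfv, rawVect_cons_even hv _ hc' hfu,
          rawVect_cons_odd hu _ (rawShift_mem v hc) hf,
          rawVect_cons_even hv _ (rawShift_mem u hc') hf, hfs,
          superSign_zero_right, one_smul] at hcs' hcv ⊢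
        rw [hcs', hcv]
        ring
      · simp only [List.nil_append, rawVect_cons_odd hu _ hc hf, rawVect_cons_odd hv _ hc hf,
          rawVect_cons_odd hu _ hc' hfv, rawVect_cons_odd hv _ hc' hfu,
          rawVect_cons_odd hu _ (rawShift_mem v hc') hf,
          rawVect_cons_odd hv _ (rawShift_mem u hc') hf, rawConj_rawConj, superSign_one_one]
          at hcs hcu hcv hfs ⊢
        -- Two odd steps conjugate twice; conjugation is an involution that anticommutes with the
        -- derivative along an odd vector, which leaves exactly a sign.
        have hcu2 : rawConj 𝕜 (rawShift u (rawConj 𝕜 c)) = (-1 : 𝕜) • rawShift u c := by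
          rw [hcu, rawConj_smul, rawConj_rawConj]
        have hcv2 : rawConj 𝕜 (rawShift v (rawConj 𝕜 c)) = (-1 : 𝕜) • rawShift v c := by
          rw [hcv, rawConj_smul, rawConj_rawConj]
        have hs : ∀ (u : V) (c : List V → V),
            rawShift u ((-1 : 𝕜) • c) = (-1 : 𝕜) • rawShift u c := fun _ _ => rfl
        rw [hcu2, hcv2, hfs, hs, hs, hcs]
        simp only [rawVect_smul_left _ _ _ hf, rawVect_smul_left _ _ _ hfu,
          rawVect_smul_left _ _ _ hfv, rawVect_smul_right]
        ring
    | cons b l ih =>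
      simp only [List.cons_append, rawVect] at ih ⊢
      rw [ih hc (rawD_mem _ hf), ih (rawShift_mem _ hc) hf, ih (rawConj_mem hc) (rawD_mem _ hf),
        ih (rawShift_mem _ (rawConj_mem hc)) hf]
      ring

/-- The recursion is natural with respect to the parity involution; this is what determines the
parity of `toEnd c`. -/
theorem rawVect_map_invol (w : List V) {c : List V → V} (hc : c ∈ formalMaps 𝕜 V)
    {f : List V → 𝕜} (hf : f ∈ formalFunctions 𝕜 V) :
    rawVect (w.map (invol 𝕜)) c f = rawVect w (rawConj 𝕜 c) (rawInvol f) := by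
  induction w generalizing c f with
  | nil => simp [rawVect, rawConj, rawInvol, invol_invol]
  | cons u w ih =>
    have hf' : ∀ u, rawD u (rawInvol f) = rawInvol (rawD (invol 𝕜 u) f) := fun _ => rfl
    have hc' : ∀ u (c : List V → V), rawShift u (rawConj 𝕜 c) =
      rawConj 𝕜 (rawShift (invol 𝕜 u) c) := fun _ _ => rfl
    simp only [List.map_cons, rawVect]
    rw [ih hc (rawD_mem _ hf), ih (rawShift_mem _ hc) hf, ih (rawConj_mem hc) (rawD_mem _ hf),
      ih (rawShift_mem _ (rawConj_mem hc)) hf]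
    simp only [hf', hc', invol_even, invol_odd, even_invol, odd_invol, rawConj_rawConj, map_neg,
      neg_neg]

theorem rawVect_continuous (w : List V) (c : List V → V) : ∃ W : Finset (List V),
    ∀ f : List V → 𝕜, (∀ w' ∈ W, f w' = 0) → rawVect w c f = 0 := by
  classical
  induction w generalizing c with
  | nil => exact ⟨{[c []]}, fun f hf => hf _ (Finset.mem_singleton_self _)⟩
  | cons u w ih =>
    obtain ⟨A, hA⟩ := ih c
    obtain ⟨B, hB⟩ := ih (rawShift (even 𝕜 u) c)
    obtain ⟨C, hC⟩ := ih (rawConj 𝕜 c)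
    obtain ⟨E, hE⟩ := ih (rawShift (odd 𝕜 u) (rawConj 𝕜 c))
    -- `A` and `C` control a derivative of `f`, whose coefficient at `w'` is the one of `f` at `v ::
    -- w'`; `B` and `E` control `f` itself.
    refine ⟨A.image (even 𝕜 u :: ·) ∪ B ∪ (C.image (odd 𝕜 u :: ·) ∪ E), fun f hf => ?_⟩
    simp only [Finset.mem_union, Finset.mem_image] at hf
    rw [rawVect, hA, hB, hC, hE]
    · simp
    · exact fun w' h => hf w' (.inr (.inr h))
    · exact fun w' h => hf _ (.inr (.inl ⟨w', h, rfl⟩))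
    · exact fun w' h => hf w' (.inl (.inr h))
    · exact fun w' h => hf _ (.inl (.inl ⟨w', h, rfl⟩))

end Raw

section

variable {𝕜 : Type*} {V : Type*} [Field 𝕜] [AddCommGroup V] [Module 𝕜 V] [Superspace 𝕜 V]

/-- The derivative of a formal map along `u`. -/
def shift (u : V) (c : formalMaps 𝕜 V) : formalMaps 𝕜 V := ⟨rawShift u c.1, rawShift_mem u c.2⟩

/-- A formal map has parity `i` if the conjugation with the parity involution multiplies it by
`(-1)^i`. -/
def HasParity (c : formalMaps 𝕜 V) (i : ZMod 2) : Prop := rawConj 𝕜 c.1 = superSign 𝕜 1 i • c.1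

theorem HasParity.shift {c : formalMaps 𝕜 V} {i k : ZMod 2} (hc : HasParity c i) {u : V}
    (hu : u ∈ part (𝕜 := 𝕜) (V := V) k) : HasParity (shift u c) (i + k) := by
  have h := rawShift_rawConj hu c.2
  rw [hc] at h
  change rawConj 𝕜 (rawShift u c.1) = superSign 𝕜 1 (i + k) • rawShift u c.1
  have h' : superSign 𝕜 1 i • rawShift u c.1 = superSign 𝕜 1 k • rawConj 𝕜 (rawShift u c.1) := h
  rw [superSign_add_right, mul_comm, mul_smul, h', smul_smul, superSign_mul_self, one_smul]

/-- The formal vector field with given Taylor coefficients, as an operator. -/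
def toEnd : formalMaps 𝕜 V →ₗ[𝕜] Module.End 𝕜 (FormalFunction 𝕜 V) :=
  LinearMap.mk₂ 𝕜
    (fun c f => (⟨fun w => rawVect w c.1 f.1, rawVect_mem c.2 f.2⟩ : formalFunctions 𝕜 V))
    (fun c d f => Subtype.ext (funext fun w => rawVect_add_left w c.1 d.1 f.2))
    (fun a c f => Subtype.ext (funext fun w => rawVect_smul_left w a c.1 f.2))
    (fun c f g => Subtype.ext (funext fun w => rawVect_add_right w c.1 f.1 g.1))
    (fun a c f => Subtype.ext (funext fun w => rawVect_smul_right w a c.1 f.1))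

variable [CharZero 𝕜]

theorem HasParity.value_mem {c : formalMaps 𝕜 V} {i : ZMod 2} (hc : HasParity c i) :
    c.1 [] ∈ part (𝕜 := 𝕜) (V := V) i :=
  mem_part_of_invol (congrFun hc [])

theorem invol_toEnd (c : formalMaps 𝕜 V) :
    invol 𝕜 (toEnd c) = toEnd ⟨rawConj 𝕜 c.1, rawConj_mem c.2⟩ := by
  refine LinearMap.ext fun f => ext_coeff fun w => ?_
  rw [invol_end_apply, invol_val]
  change rawVect (w.map (invol 𝕜)) c.1 (invol 𝕜 f).1 = rawVect w (rawConj 𝕜 c.1) f.1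
  rw [rawVect_map_invol w c.2 (invol 𝕜 f).2, invol_val, rawInvol_rawInvol]

theorem HasParity.toEnd_mem {c : formalMaps 𝕜 V} {i : ZMod 2} (hc : HasParity c i) :
    toEnd c ∈ part (𝕜 := 𝕜) (V := Module.End 𝕜 (FormalFunction 𝕜 V)) i := by
  refine mem_part_of_invol ?_
  rw [invol_toEnd, ← map_smul]
  exact congrArg toEnd (Subtype.ext hc)

/-- The bracket with a constant vector field is the derivative of the coefficients. -/
theorem br_toEnd_pderiv (c : formalMaps 𝕜 V) {k : ZMod 2} {u : V}
    (hu : u ∈ part (𝕜 := 𝕜) (V := V) k) :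
    br (𝕜 := 𝕜) (toEnd c) (pderiv u) = toEnd (shift u c) := by
  refine LinearMap.ext fun f => ext_coeff fun w => ?_
  rcases parity_cases k with rfl | rfl
  · rw [br_of_even _ (pderiv_mem hu).1]
    change rawVect w c.1 (rawD u f.1) - rawVect (u :: w) c.1 f.1 = rawVect w (rawShift u c.1) f.1
    rw [rawVect_cons_even hu w c.2 f.2, sub_sub_cancel]
  · rw [br_of_odd _ (pderiv_mem hu).1, invol_toEnd]
    change rawVect w c.1 (rawD u f.1) - rawVect (u :: w) (rawConj 𝕜 c.1) f.1 =
      rawVect w (rawShift u c.1) f.1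
    rw [rawVect_cons_odd hu w (rawConj_mem c.2) f.2, rawConj_rawConj, sub_sub_cancel]

end

end FormalMap

/-! ### Multiplication operators. -/

namespace FormalFunction

variable {𝕜 : Type*} {V : Type*} [Field 𝕜] [AddCommGroup V] [Module 𝕜 V] [Superspace 𝕜 V]

theorem rawMul_map_invol (w : List V) {f g : List V → 𝕜} (hg : g ∈ formalFunctions 𝕜 V) :
    rawMul (w.map (invol 𝕜)) f g = rawMul w (rawInvol f) (rawInvol g) := by
  induction w generalizing f g with
  | nil => rfl
  | cons u w ih =>
    have h : ∀ (u : V) (f : List V → 𝕜), rawD u (rawInvol f) = rawInvol (rawD (invol 𝕜 u) f) :=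
      fun _ _ => rfl
    simp only [List.map_cons, rawMul, h, ih hg, ih (rawD_mem _ hg), even_invol, odd_invol,
      invol_even, invol_odd]

variable [CharZero 𝕜]

theorem mul_mem_end {j : ZMod 2} {f : FormalFunction 𝕜 V}
    (hf : f ∈ part (𝕜 := 𝕜) (V := FormalFunction 𝕜 V) j) :
    mul f ∈ part (𝕜 := 𝕜) (V := Module.End 𝕜 (FormalFunction 𝕜 V)) j := by
  intro k g hg
  have hf' : rawInvol f.1 = superSign 𝕜 1 j • f.1 := hf
  have hg' : rawInvol g.1 = superSign 𝕜 1 k • g.1 := hg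
  change rawInvol (fun w => rawMul w f.1 g.1) = superSign 𝕜 1 (j + k) • fun w => rawMul w f.1 g.1
  funext w
  change rawMul (w.map (invol 𝕜)) f.1 g.1 = superSign 𝕜 1 (j + k) * rawMul w f.1 g.1
  rw [rawMul_map_invol w g.2, hf', hg', rawMul_smul_left, rawMul_smul_right, superSign_add_right,
    mul_assoc]

/-- This is the Leibniz rule for `∂_u`, written as a commutator with a multiplication operator so
that the vanishing criterion can use it. -/
theorem br_mul_pderiv {j k : ZMod 2} {f : FormalFunction 𝕜 V}
    (hf : f ∈ part (𝕜 := 𝕜) (V := FormalFunction 𝕜 V) j) {u : V}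
    (hu : u ∈ part (𝕜 := 𝕜) (V := V) k) :
    br (𝕜 := 𝕜) (mul f) (pderiv u) = -(superSign 𝕜 j k • mul (pderiv u f)) := by
  have hu' := pderiv_mem (𝕜 := 𝕜) hu
  rw [br_skew j k _ (mul_mem_end hf) _ hu'.1]
  congr 2
  refine LinearMap.ext fun g => ?_
  rw [br_apply_of_mem hu'.1 (mul_mem_end hf), hu'.2 j f hf g, add_sub_cancel_right]

end FormalFunction

/-! ### The operators defined by formal maps are formal vector fields. -/

namespace FormalMap

variable {𝕜 : Type*} {V : Type*} [Field 𝕜] [CharZero 𝕜] [AddCommGroup V] [Module 𝕜 V]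
  [Superspace 𝕜 V]

theorem pderiv_toEnd {c : formalMaps 𝕜 V} {i k : ZMod 2} (hc : HasParity c i) {u : V}
    (hu : u ∈ part (𝕜 := 𝕜) (V := V) k) (f : FormalFunction 𝕜 V) :
    pderiv u (toEnd c f) =
      superSign 𝕜 i k • (toEnd c (pderiv u f) - toEnd (shift u c) f) := by
  rw [← br_toEnd_pderiv c hu, br_apply_of_mem hc.toEnd_mem (pderiv_mem hu).1, sub_sub_cancel,
    smul_smul, superSign_mul_self, one_smul]

/-- This is the Leibniz rule in operator form. At the origin `toEnd c` acts as the derivative along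
`c []`, for which the rule is known; the rest is the vanishing criterion. -/
theorem br_toEnd_mul {c : formalMaps 𝕜 V} {i j : ZMod 2} (hc : HasParity c i)
    {f : FormalFunction 𝕜 V} (hf : f ∈ part (𝕜 := 𝕜) (V := FormalFunction 𝕜 V) j) :
    br (𝕜 := 𝕜) (toEnd c) (mul f) = mul (toEnd c f) := by
  -- Both `c` and `f` must vary, because bracketing with `∂_u` differentiates one or the other.
  let G : Set (Module.End 𝕜 (FormalFunction 𝕜 V)) := {A | ∃ i j, ∃ c : formalMaps 𝕜 V,
    HasParity c i ∧ ∃ f ∈ part (𝕜 := 𝕜) (V := FormalFunction 𝕜 V) j,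
      A = br (𝕜 := 𝕜) (toEnd c) (mul f) - mul (toEnd c f)}
  refine sub_eq_zero.1 (eq_zero_of_mem_generators G ?_ ?_ ⟨i, j, c, hc, f, hf, rfl⟩)
  · rintro _ ⟨i, j, c, hc, f, hf, rfl⟩ g
    rw [LinearMap.sub_apply, br_apply_of_mem hc.toEnd_mem (mul_mem_end hf)]
    have h : (pderiv (c.1 []) (mul f g)).1 [] = (mul (pderiv (c.1 []) f) g +
      superSign 𝕜 i j • mul f (pderiv (c.1 []) g)).1 [] :=
      congrArg (fun h : FormalFunction 𝕜 V => h.1 []) ((pderiv_mem hc.value_mem).2 j f hf g)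
    have h' : (mul f g).1 [c.1 []] = f.1 [c.1 []] * g.1 [] +
      superSign 𝕜 i j * (f.1 [] * g.1 [c.1 []]) := h
    change (mul f g).1 [c.1 []] - superSign 𝕜 i j * (f.1 [] * g.1 [c.1 []]) -
      f.1 [c.1 []] * g.1 [] = 0
    rw [h']
    ring
  · rintro _ ⟨i, j, c, hc, f, hf, rfl⟩ k u hu
    have hf' := mul_mem_end hf
    have hu' := (pderiv_mem (𝕜 := 𝕜) hu).1
    have h1 : br (𝕜 := 𝕜) (toEnd c) (mul (pderiv u f)) - mul (toEnd c (pderiv u f)) ∈ G :=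
      ⟨i, k + j, c, hc, _, hu' j f hf, rfl⟩
    have h2 : br (𝕜 := 𝕜) (toEnd (shift u c)) (mul f) - mul (toEnd (shift u c) f) ∈ G :=
      ⟨i + k, j, _, hc.shift hu, f, hf, rfl⟩
    -- By the Jacobi identity the defect for `(c, f)`, bracketed with `∂_u`, is this combination of
    -- the defects for `(shift u c, f)` and `(c, ∂_u f)`.
    have h := Submodule.smul_mem _ (superSign 𝕜 j k)
      (sub_mem (Submodule.subset_span (R := 𝕜) h2) (Submodule.subset_span (R := 𝕜) h1))
    convert h using 1
    rw [map_sub, LinearMap.sub_apply, br_br hc.toEnd_mem hf' hu', br_toEnd_pderiv c hu,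
      br_mul_pderiv hf hu, br_mul_pderiv (hc.toEnd_mem j f hf) hu, pderiv_toEnd hc hu,
      br_skew j (i + k) _ hf' _ (hc.shift hu).toEnd_mem]
    simp only [map_neg, map_smul, map_sub, smul_neg, smul_sub, smul_smul, superSign_add_left,
      superSign_add_right, superSign_comm 𝕜 i j, ← mul_assoc, superSign_mul_self, one_mul]
    rw [mul_comm (superSign 𝕜 i k), mul_assoc, superSign_mul_self, mul_one]
    abel

theorem HasParity.toEnd_mem_superDer {c : formalMaps 𝕜 V} {i : ZMod 2} (hc : HasParity c i) :
    toEnd c ∈ superDer (mul (𝕜 := 𝕜) (V := V)) i := by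
  refine ⟨hc.toEnd_mem, fun j f hf g => ?_⟩
  rw [← br_toEnd_mul hc hf, br_apply_of_mem hc.toEnd_mem (mul_mem_end hf), sub_add_cancel]

theorem HasParity.toEnd_mem_formalVect {c : formalMaps 𝕜 V} {i : ZMod 2} (hc : HasParity c i) :
    toEnd c ∈ (formalVect 𝕜 V).toSubmodule := by
  have hcont : ∀ w : List V, ∃ W : Finset (List V), ∀ f : FormalFunction 𝕜 V,
      (∀ w' ∈ W, f.1 w' = 0) → (toEnd c f).1 w = 0 := fun w =>
    (rawVect_continuous w c.1).imp fun W hW f hf => hW f.1 hf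
  rcases parity_cases i with rfl | rfl
  · exact Submodule.mem_sup_left ⟨hc.toEnd_mem_superDer, hcont⟩
  · exact Submodule.mem_sup_right ⟨hc.toEnd_mem_superDer, hcont⟩

/-- The value of the bracket of two formal vector fields at the origin. -/
theorem br_toEnd_apply_nil {c d : formalMaps 𝕜 V} {i j : ZMod 2} (hc : HasParity c i)
    (hd : HasParity d j) (f : FormalFunction 𝕜 V) :
    (br (𝕜 := 𝕜) (toEnd c) (toEnd d) f).1 [] =
      f.1 [c.1 [d.1 []] - superSign 𝕜 i j • d.1 [c.1 []]] := by
  rw [br_apply_of_mem hc.toEnd_mem hd.toEnd_mem]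
  have h1 := congrArg (fun g : FormalFunction 𝕜 V => g.1 []) (pderiv_toEnd hd hc.value_mem f)
  have h2 := congrArg (fun g : FormalFunction 𝕜 V => g.1 []) (pderiv_toEnd hc hd.value_mem f)
  change (toEnd d f).1 [c.1 []] =
    superSign 𝕜 j i * (f.1 [c.1 [], d.1 []] - f.1 [d.1 [c.1 []]]) at h1
  change (toEnd c f).1 [d.1 []] =
    superSign 𝕜 i j * (f.1 [d.1 [], c.1 []] - f.1 [c.1 [d.1 []]]) at h2
  change (toEnd d f).1 [c.1 []] - superSign 𝕜 i j * (toEnd c f).1 [d.1 []] = _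
  -- The second derivatives of `f` in the two products agree up to this sign and cancel, leaving
  -- first derivatives only.
  have hs : f.1 [c.1 [], d.1 []] = superSign 𝕜 i j * f.1 [d.1 [], c.1 []] :=
    f.2.2.2 [] [] i j _ hc.value_mem _ hd.value_mem
  have ha : f.1 [c.1 [d.1 []] - superSign 𝕜 i j • d.1 [c.1 []]] =
      f.1 [c.1 [d.1 []]] - superSign 𝕜 i j * f.1 [d.1 [c.1 []]] := by
    have h1 := f.2.1 [] [] (c.1 [d.1 []]) ((-superSign 𝕜 i j) • d.1 [c.1 []])
    have h2 := f.2.2.1 [] [] (-superSign 𝕜 i j) (d.1 [c.1 []])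
    simp only [List.nil_append] at h1 h2
    rw [sub_eq_add_neg, ← neg_smul, h1, h2]
    ring
  rw [h1, h2, hs, ha, superSign_comm 𝕜 j i]
  linear_combination (f.1 [c.1 [d.1 []]]) * superSign_mul_self 𝕜 i j

end FormalMap

/-! ### Iterated brackets and derivations preserving `K`. -/

section Graded

variable {𝕜 : Type*} {L : Type*} [Field 𝕜] [AddCommGroup L] [Module 𝕜 L] [LieSuperalgebra 𝕜 L]

theorem invol_br (x y : L) :
    invol 𝕜 (br (𝕜 := 𝕜) x y) = br (𝕜 := 𝕜) (invol 𝕜 x) (invol 𝕜 y) := by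
  refine hom_induction (𝕜 := 𝕜)
    (p := fun x => invol 𝕜 (br (𝕜 := 𝕜) x y) = br (𝕜 := 𝕜) (invol 𝕜 x) (invol 𝕜 y)) x
    (fun x x' hx hx' => by simp [hx, hx']) fun i x hx => ?_
  refine hom_induction (𝕜 := 𝕜)
    (p := fun y => invol 𝕜 (br (𝕜 := 𝕜) x y) = br (𝕜 := 𝕜) (invol 𝕜 x) (invol 𝕜 y)) y
    (fun y y' hy hy' => by simp [hy, hy']) fun j y hy => ?_
  rw [invol_of_mem hx, invol_of_mem hy, invol_of_mem (br_mem i j x hx y hy), superSign_add_right]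
  simp only [map_smul, LinearMap.smul_apply, smul_smul, mul_comm]

theorem iterBr_append (x : L) (l r : List L) :
    iterBr 𝕜 x (l ++ r) = iterBr 𝕜 (iterBr 𝕜 x l) r :=
  List.foldl_append

theorem iterBr_cons (x y : L) (l : List L) :
    iterBr 𝕜 x (y :: l) = iterBr 𝕜 (br (𝕜 := 𝕜) x y) l := rfl

theorem iterBr_add (x y : L) (l : List L) :
    iterBr 𝕜 (x + y) l = iterBr 𝕜 x l + iterBr 𝕜 y l := by
  induction l generalizing x y with
  | nil => rfl
  | cons z l ih => simp only [iterBr_cons, map_add, LinearMap.add_apply, ih]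

theorem iterBr_smul (a : 𝕜) (x : L) (l : List L) : iterBr 𝕜 (a • x) l = a • iterBr 𝕜 x l := by
  induction l generalizing x with
  | nil => rfl
  | cons z l ih => simp only [iterBr_cons, map_smul, LinearMap.smul_apply, ih]

theorem iterBr_sub (x y : L) (l : List L) :
    iterBr 𝕜 (x - y) l = iterBr 𝕜 x l - iterBr 𝕜 y l := by
  rw [eq_sub_iff_add_eq, ← iterBr_add, sub_add_cancel]

theorem invol_iterBr (x : L) (l : List L) :
    invol 𝕜 (iterBr 𝕜 x l) = iterBr 𝕜 (invol 𝕜 x) (l.map (invol 𝕜)) := by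
  induction l generalizing x with
  | nil => rfl
  | cons z l ih => rw [iterBr_cons, ih, invol_br]; rfl

/-- By the Jacobi identity the two sides differ by `[z, [u, v]] = 0`. This makes iterated brackets
with elements of an Abelian subalgebra graded symmetric. -/
theorem br_br_swap {i j : ZMod 2} {u v : L} (hu : u ∈ part (𝕜 := 𝕜) (V := L) i)
    (hv : v ∈ part (𝕜 := 𝕜) (V := L) j) (huv : br (𝕜 := 𝕜) u v = 0) (z : L) :
    br (𝕜 := 𝕜) (br (𝕜 := 𝕜) z u) v = superSign 𝕜 i j • br (𝕜 := 𝕜) (br (𝕜 := 𝕜) z v) u := by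
  refine hom_induction (𝕜 := 𝕜) (p := fun z => br (𝕜 := 𝕜) (br (𝕜 := 𝕜) z u) v =
    superSign 𝕜 i j • br (𝕜 := 𝕜) (br (𝕜 := 𝕜) z v) u) z
    (fun z z' hz hz' => by simp [hz, hz']) fun k z hz => ?_
  rw [br_br hz hu hv, huv, map_zero, zero_sub, br_skew _ _ u hu _ (br_mem k j z hz v hv), smul_neg,
    neg_neg, smul_smul, superSign_add_right, superSign_comm 𝕜 k i, ← mul_assoc,
    superSign_mul_self, one_mul]

namespace LieSubsuperalgebra

theorem incl_invol (S : LieSubsuperalgebra 𝕜 L) (a : S.Elem) :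
    S.incl (invol 𝕜 a) = invol 𝕜 (S.incl a) := by
  refine hom_induction (𝕜 := 𝕜) (p := fun a : S.Elem => S.incl (invol 𝕜 a) = invol 𝕜 (S.incl a)) a
    (fun a b ha hb => by simp [ha, hb]) fun i a ha => ?_
  rw [invol_of_mem ha, invol_of_mem (show S.incl a ∈ part (𝕜 := 𝕜) (V := L) i from ha), map_smul]

theorem invol_mem (S : LieSubsuperalgebra 𝕜 L) {x : L} (hx : x ∈ S.toSubmodule) :
    invol 𝕜 x ∈ S.toSubmodule :=
  sub_mem (S.even_mem' x hx) (S.odd_mem' x hx)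

theorem incl_iterBr (S : LieSubsuperalgebra 𝕜 L) (x : S.Elem) (l : List S.Elem) :
    S.incl (iterBr 𝕜 x l) = iterBr 𝕜 (S.incl x) (l.map S.incl) := by
  induction l generalizing x with
  | nil => rfl
  | cons y l ih => exact ih _

theorem mem_of_mem_ofParts {A : ZMod 2 → Submodule 𝕜 L}
    {hA : ∀ i, A i ≤ part (𝕜 := 𝕜) (V := L) i}
    {hbr : ∀ i j, ∀ x ∈ A i, ∀ y ∈ A j, br (𝕜 := 𝕜) x y ∈ A (i + j)} {i : ZMod 2} {x : L}
    (hx : x ∈ (ofParts A hA hbr).toSubmodule) (hi : x ∈ part (𝕜 := 𝕜) (V := L) i) : x ∈ A i := by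
  obtain ⟨y, hy, z, hz, rfl⟩ := Submodule.mem_sup.1 hx
  rcases parity_cases i with rfl | rfl
  · have h := odd_of_mem_zero hi
    rw [map_add, odd_of_mem_zero (hA 0 hy), odd_of_mem_one (hA 1 hz), zero_add] at h
    rwa [h, add_zero]
  · have h := even_of_mem_one hi
    rw [map_add, even_of_mem_zero (hA 0 hy), even_of_mem_one (hA 1 hz), add_zero] at h
    rwa [h, zero_add]

end LieSubsuperalgebra

namespace derPreserving

variable {K : LieSubsuperalgebra 𝕜 L}

theorem mem_superDer {D : (derPreserving K).Elem} {i : ZMod 2}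
    (hD : D ∈ part (𝕜 := 𝕜) (V := (derPreserving K).Elem) i) :
    (derPreserving K).incl D ∈ superDer (br (𝕜 := 𝕜) (L := L)) i :=
  (LieSubsuperalgebra.mem_of_mem_ofParts D.2 hD).1

theorem apply_mem (D : (derPreserving K).Elem) {x : L} (hx : x ∈ K.toSubmodule) :
    (derPreserving K).incl D x ∈ K.toSubmodule := by
  refine hom_induction (𝕜 := 𝕜)
    (p := fun D => (derPreserving K).incl D x ∈ K.toSubmodule) D
    (fun D E hD hE => ?_) fun i D hD => (LieSubsuperalgebra.mem_of_mem_ofParts D.2 hD).2 x hx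
  rw [map_add]
  exact add_mem hD hE

/-- Apply `D` to `[u, v] = 0`. This is the symmetry of derived brackets in their first two
arguments. -/
theorem br_apply_swap {i j : ZMod 2} {u v : L} (hu : u ∈ part (𝕜 := 𝕜) (V := L) i)
    (hv : v ∈ part (𝕜 := 𝕜) (V := L) j) (huv : br (𝕜 := 𝕜) u v = 0)
    (D : (derPreserving K).Elem) :
    br (𝕜 := 𝕜) ((derPreserving K).incl D u) v =
      superSign 𝕜 i j • br (𝕜 := 𝕜) ((derPreserving K).incl D v) u := by
  refine hom_induction (𝕜 := 𝕜) (p := fun D => br (𝕜 := 𝕜) ((derPreserving K).incl D u) v =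
      superSign 𝕜 i j • br (𝕜 := 𝕜) ((derPreserving K).incl D v) u) D
    (fun D E hD hE => by simp [hD, hE]) fun k D hD => ?_
  obtain ⟨hD1, hD2⟩ := mem_superDer hD
  have h := hD2 i u hu v
  rw [huv, map_zero] at h
  rw [eq_neg_of_add_eq_zero_left h.symm, br_skew _ _ u hu _ (hD1 j v hv), smul_neg, neg_neg,
    smul_smul, superSign_add_right, superSign_comm 𝕜 k i, ← mul_assoc, superSign_mul_self, one_mul]

end derPreserving

end Graded

/-! ### Derived brackets as Taylor coefficients. -/

namespace DerivedBracket

variable {𝕜 : Type*} {L : Type*} [Field 𝕜] [AddCommGroup L] [Module 𝕜 L] [LieSuperalgebra 𝕜 L]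
  {K V : LieSubsuperalgebra 𝕜 L} (h : IsCompl V.toSubmodule K.toSubmodule)

/-- The projector on `V` parallel to `K`. -/
def proj : L →ₗ[𝕜] V.Elem := V.toSubmodule.projectionOnto K.toSubmodule h

theorem proj_incl (a : V.Elem) : proj h (V.incl a) = a :=
  Submodule.projectionOnto_apply_left h a

theorem proj_of_mem {x : L} (hx : x ∈ K.toSubmodule) : proj h x = 0 :=
  (Submodule.projectionOnto_apply_eq_zero_iff h).2 hx

theorem sub_proj_mem (x : L) : x - V.incl (proj h x) ∈ K.toSubmodule := by
  refine (Submodule.projectionOnto_apply_eq_zero_iff h).1 ?_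
  change proj h _ = 0
  rw [map_sub, proj_incl, sub_self]

/-- `P` is even because both `K` and `V` are graded subspaces. -/
theorem proj_invol (x : L) : proj h (invol 𝕜 x) = invol 𝕜 (proj h x) := by
  have hx := proj_of_mem h (K.invol_mem (sub_proj_mem h x))
  rw [map_sub, map_sub, ← V.incl_invol, proj_incl] at hx
  exact sub_eq_zero.1 hx

/-- The Taylor coefficients `P[…[[x, a₁], a₂], …, a_k]`. -/
def rawInner (x : L) (w : List V.Elem) : V.Elem := proj h (iterBr 𝕜 x (w.map V.incl))

/-- The Taylor coefficients `P[…[D a₁, a₂], …, a_k]`. -/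
def rawOuter (D : Module.End 𝕜 L) : List V.Elem → V.Elem
  | [] => 0
  | a :: w => rawInner h (D (V.incl a)) w

theorem rawInner_add (x y : L) (w : List V.Elem) :
    rawInner h (x + y) w = rawInner h x w + rawInner h y w := by
  rw [rawInner, iterBr_add, map_add]; rfl

theorem rawInner_smul (a : 𝕜) (x : L) (w : List V.Elem) :
    rawInner h (a • x) w = a • rawInner h x w := by
  rw [rawInner, iterBr_smul, map_smul]; rfl

theorem rawConj_rawInner (x : L) :
    FormalMap.rawConj 𝕜 (rawInner h x) = rawInner h (invol 𝕜 x) := by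
  funext w
  have hi : (V.incl ∘ invol 𝕜 : V.Elem → L) = invol 𝕜 ∘ V.incl := funext V.incl_invol
  rw [FormalMap.rawConj, rawInner, ← proj_invol, invol_iterBr, List.map_map, List.map_map, ← hi,
    Function.comp_assoc, show (invol 𝕜 ∘ invol 𝕜 : V.Elem → V.Elem) = id from funext invol_invol]
  rfl

theorem rawConj_rawOuter (D : Module.End 𝕜 L) :
    FormalMap.rawConj 𝕜 (rawOuter h D) = rawOuter h (invol 𝕜 D) := by
  funext w
  cases w with
  | nil => exact map_zero _
  | cons a w =>
    have := congrFun (rawConj_rawInner h (D (V.incl (invol 𝕜 a)))) w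
    rw [V.incl_invol, ← invol_end_apply, ← V.incl_invol] at this
    exact this

theorem rawInner_mem (hV : ∀ a ∈ V.toSubmodule, ∀ b ∈ V.toSubmodule, br (𝕜 := 𝕜) a b = 0)
    (x : L) : rawInner h x ∈ formalMaps 𝕜 V.Elem := by
  refine ⟨fun l r u v => ?_, fun l r a u => ?_, fun l r i j u hu v hv => ?_⟩
  · simp only [rawInner, List.map_append, List.map_cons, iterBr_append, iterBr_cons, map_add,
      iterBr_add]
  · simp only [rawInner, List.map_append, List.map_cons, iterBr_append, iterBr_cons, map_smul,
      iterBr_smul]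
  · simp only [rawInner, List.map_append, List.map_cons, iterBr_append, iterBr_cons]
    rw [br_br_swap (show V.incl u ∈ part i from hu) (show V.incl v ∈ part j from hv)
      (hV _ u.2 _ v.2), iterBr_smul, map_smul]

theorem rawOuter_mem (hV : ∀ a ∈ V.toSubmodule, ∀ b ∈ V.toSubmodule, br (𝕜 := 𝕜) a b = 0)
    (D : (derPreserving K).Elem) :
    rawOuter h ((derPreserving K).incl D) ∈ formalMaps 𝕜 V.Elem := by
  refine ⟨fun l r u v => ?_, fun l r a u => ?_, fun l r i j u hu v hv => ?_⟩
  · cases l with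
    | nil => simp only [List.nil_append, rawOuter, map_add, rawInner_add]
    | cons b l => exact (rawInner_mem h hV _).1 l r u v
  · cases l with
    | nil => simp only [List.nil_append, rawOuter, map_smul, rawInner_smul]
    | cons b l => exact (rawInner_mem h hV _).2.1 l r a u
  · cases l with
    | nil =>
      simp only [List.nil_append, rawOuter, rawInner, List.map_cons, iterBr_cons]
      rw [derPreserving.br_apply_swap (show V.incl u ∈ part i from hu)
        (show V.incl v ∈ part j from hv) (hV _ u.2 _ v.2), iterBr_smul, map_smul]
    -- Away from the first argument only the Abelian property of `V` matters; the derivation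
    -- property of `D` served for the first pair.
    | cons b l => exact (rawInner_mem h hV _).2.2 l r i j u hu v hv

variable (hV : ∀ a ∈ V.toSubmodule, ∀ b ∈ V.toSubmodule, br (𝕜 := 𝕜) a b = 0)

/-- The formal map with the Taylor coefficients `P[…[[x, a₁], a₂], …, a_k]`, for `x ∈ L`. -/
def inner : L →ₗ[𝕜] formalMaps 𝕜 V.Elem where
  toFun x := ⟨rawInner h x, rawInner_mem h hV x⟩
  map_add' x y := Subtype.ext (funext fun w => rawInner_add h x y w)
  map_smul' a x := Subtype.ext (funext fun w => rawInner_smul h a x w)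

/-- The formal map whose Taylor coefficients are the higher derived brackets of `D`. -/
def outer : (derPreserving K).Elem →ₗ[𝕜] formalMaps 𝕜 V.Elem where
  toFun D := ⟨rawOuter h ((derPreserving K).incl D), rawOuter_mem h hV D⟩
  map_add' D E := Subtype.ext (funext fun w => by
    cases w with
    | nil => exact (add_zero (0 : V.Elem)).symm
    | cons a w => exact rawInner_add h _ _ w)
  map_smul' c D := Subtype.ext (funext fun w => by
    cases w with
    | nil => exact (smul_zero (A := V.Elem) c).symm
    | cons a w => exact rawInner_smul h c _ w)

theorem inner_hasParity {i : ZMod 2} {x : L} (hx : x ∈ part (𝕜 := 𝕜) (V := L) i) :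
    FormalMap.HasParity (inner h hV x) i := by
  refine (rawConj_rawInner h x).trans ?_
  rw [invol_of_mem hx]
  exact funext fun w => rawInner_smul h _ x w

theorem outer_hasParity {i : ZMod 2} {D : (derPreserving K).Elem}
    (hD : D ∈ part (𝕜 := 𝕜) (V := (derPreserving K).Elem) i) :
    FormalMap.HasParity (outer h hV D) i := by
  refine (rawConj_rawOuter h _).trans ?_
  rw [← LieSubsuperalgebra.incl_invol, invol_of_mem hD]
  exact congrArg Subtype.val (map_smul (outer h hV) (superSign 𝕜 1 i) D)

theorem shift_inner (u : V.Elem) (x : L) :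
    FormalMap.shift u (inner h hV x) = inner h hV (br (𝕜 := 𝕜) x (V.incl u)) := rfl

/-- As `shift` is the bracket with `∂_u`, this reads `[Q_D, ∂_u] = X_{Du}`: one derivative passes
from derivations to elements of `L`. -/
theorem shift_outer (u : V.Elem) (D : (derPreserving K).Elem) :
    FormalMap.shift u (outer h hV D) = inner h hV ((derPreserving K).incl D (V.incl u)) := rfl

/-- `P` kills `[x - Px, y - Py]`, which lies in the subalgebra `K`; expand and use `[Px, Py] = 0`.
-/
theorem proj_br (hV : ∀ a ∈ V.toSubmodule, ∀ b ∈ V.toSubmodule, br (𝕜 := 𝕜) a b = 0)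
    (x y : L) : proj h (br (𝕜 := 𝕜) x y) = proj h (br (𝕜 := 𝕜) x (V.incl (proj h y))) +
      proj h (br (𝕜 := 𝕜) (V.incl (proj h x)) y) := by
  have hk := proj_of_mem h (K.br_mem' _ (sub_proj_mem h x) _ (sub_proj_mem h y))
  have h0 : br (𝕜 := 𝕜) (V.incl (proj h x)) (V.incl (proj h y)) = 0 :=
    hV _ (proj h x).2 _ (proj h y).2
  simp only [map_sub, LinearMap.sub_apply, h0, sub_zero] at hk
  rw [sub_sub, sub_eq_zero] at hk
  rw [hk, add_comm]

variable [CharZero 𝕜]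

open FormalMap

/-- At the origin this is `proj_br`. Bracketing with `∂_u` gives, by the Jacobi identity in `L` and
among operators, the same relation for the pairs `(x, [y, u])` and `(y, [x, u])`. -/
theorem br_toEnd_inner {i j : ZMod 2} {x y : L} (hx : x ∈ part (𝕜 := 𝕜) (V := L) i)
    (hy : y ∈ part (𝕜 := 𝕜) (V := L) j) :
    br (𝕜 := 𝕜) (toEnd (inner h hV x)) (toEnd (inner h hV y)) =
      toEnd (inner h hV (br (𝕜 := 𝕜) x y)) := by
  let G : Set (Module.End 𝕜 (FormalFunction 𝕜 V.Elem)) := {A | ∃ i j,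
    ∃ x ∈ part (𝕜 := 𝕜) (V := L) i, ∃ y ∈ part (𝕜 := 𝕜) (V := L) j,
      A = br (𝕜 := 𝕜) (toEnd (inner h hV x)) (toEnd (inner h hV y)) -
        toEnd (inner h hV (br (𝕜 := 𝕜) x y))}
  refine sub_eq_zero.1 (eq_zero_of_mem_generators G ?_ ?_ ⟨i, j, x, hx, y, hy, rfl⟩)
  · rintro _ ⟨i, j, x, hx, y, hy, rfl⟩ f
    have hpx : V.incl (proj h x) ∈ part (𝕜 := 𝕜) (V := L) i := (inner_hasParity h hV hx).value_mem
    have h1 := br_toEnd_apply_nil (inner_hasParity h hV hx) (inner_hasParity h hV hy) f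
    have h2 : (inner h hV x).1 [(inner h hV y).1 []] -
        superSign 𝕜 i j • (inner h hV y).1 [(inner h hV x).1 []] = proj h (br (𝕜 := 𝕜) x y) := by
      rw [proj_br h hV x y, br_skew i j _ hpx y hy, map_neg, map_smul, ← sub_eq_add_neg]
      rfl
    rw [h2] at h1
    exact sub_eq_zero.2 h1
  · rintro _ ⟨i, j, x, hx, y, hy, rfl⟩ k u hu
    have hu' : V.incl u ∈ part (𝕜 := 𝕜) (V := L) k := hu
    have hX := (inner_hasParity h hV hx).toEnd_mem
    have hY := (inner_hasParity h hV hy).toEnd_mem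
    have h1 : _ ∈ G := ⟨i, j + k, x, hx, _, br_mem j k y hy _ hu', rfl⟩
    have h2 : _ ∈ G := ⟨j, i + k, y, hy, _, br_mem i k x hx _ hu', rfl⟩
    have h := sub_mem (Submodule.subset_span (R := 𝕜) h1)
      (Submodule.smul_mem _ (superSign 𝕜 i j) (Submodule.subset_span (R := 𝕜) h2))
    convert h using 1
    rw [map_sub, LinearMap.sub_apply, br_br hX hY (pderiv_mem hu).1, br_toEnd_pderiv _ hu,
      br_toEnd_pderiv _ hu, br_toEnd_pderiv _ hu, shift_inner, shift_inner, shift_inner,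
      br_br hx hy hu', map_sub, map_sub, map_smul, map_smul, smul_sub]
    abel

/-- Bracketing with `∂_u` replaces `x` by `[x, u]`; the remaining term `[X_x, X_{Du}]` is known from
`br_toEnd_inner` and matches the derivation rule for `D[x, u]`. -/
theorem br_toEnd_outer_inner {i j : ZMod 2} {D : (derPreserving K).Elem}
    (hD : D ∈ part (𝕜 := 𝕜) (V := (derPreserving K).Elem) i) {x : L}
    (hx : x ∈ part (𝕜 := 𝕜) (V := L) j) :
    br (𝕜 := 𝕜) (toEnd (outer h hV D)) (toEnd (inner h hV x)) =
      toEnd (inner h hV ((derPreserving K).incl D x)) := by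
  let G : Set (Module.End 𝕜 (FormalFunction 𝕜 V.Elem)) := {A | ∃ j,
    ∃ x ∈ part (𝕜 := 𝕜) (V := L) j,
      A = br (𝕜 := 𝕜) (toEnd (outer h hV D)) (toEnd (inner h hV x)) -
        toEnd (inner h hV ((derPreserving K).incl D x))}
  have hQ := outer_hasParity h hV hD
  obtain ⟨hD1, hD2⟩ := derPreserving.mem_superDer hD
  refine sub_eq_zero.1 (eq_zero_of_mem_generators G ?_ ?_ ⟨j, x, hx, rfl⟩)
  · rintro _ ⟨j, x, hx, rfl⟩ f
    have h1 := br_toEnd_apply_nil hQ (inner_hasParity h hV hx) f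
    have h0 : (inner h hV x).1 [0] = 0 := congrFun (rawShift_zero (inner h hV x).2) []
    have h2 : (outer h hV D).1 [(inner h hV x).1 []] -
        superSign 𝕜 i j • (inner h hV x).1 [(outer h hV D).1 []] =
          proj h ((derPreserving K).incl D x) := by
      -- Here `D(K) ⊂ K` enters: `D (x - Px)` lies in `K`, hence `P D x = P D P x`.
      have hk := proj_of_mem h (derPreserving.apply_mem D (sub_proj_mem h x))
      rw [map_sub, map_sub] at hk
      rw [sub_eq_zero.1 hk, show (outer h hV D).1 [] = 0 from rfl, h0, smul_zero, sub_zero]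
      rfl
    rw [h2] at h1
    exact sub_eq_zero.2 h1
  · rintro _ ⟨j, x, hx, rfl⟩ k u hu
    have hu' : V.incl u ∈ part (𝕜 := 𝕜) (V := L) k := hu
    have hX := (inner_hasParity h hV hx).toEnd_mem
    have h1 : _ ∈ G := ⟨j + k, _, br_mem j k x hx _ hu', rfl⟩
    have hspan := Submodule.subset_span (R := 𝕜) h1
    rw [SetLike.mem_coe] at hspan
    convert hspan using 1
    rw [map_sub, LinearMap.sub_apply, br_br hQ.toEnd_mem hX (pderiv_mem hu).1,
      br_toEnd_pderiv _ hu, br_toEnd_pderiv _ hu, br_toEnd_pderiv _ hu, shift_inner, shift_inner,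
      shift_outer, br_toEnd_inner h hV hx (hD1 k _ hu'), hD2 j x hx, map_add, map_add, map_smul,
      map_smul]
    abel

/-- No family is needed: both sides vanish at the origin, and their brackets with `∂_u` are both
`X_{[D,E]u}` by `br_toEnd_outer_inner`. -/
theorem br_toEnd_outer {i j : ZMod 2} {D E : (derPreserving K).Elem}
    (hD : D ∈ part (𝕜 := 𝕜) (V := (derPreserving K).Elem) i)
    (hE : E ∈ part (𝕜 := 𝕜) (V := (derPreserving K).Elem) j) :
    br (𝕜 := 𝕜) (toEnd (outer h hV D)) (toEnd (outer h hV E)) =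
      toEnd (outer h hV (br (𝕜 := 𝕜) D E)) := by
  have hQ := outer_hasParity h hV hD
  have hR := outer_hasParity h hV hE
  obtain ⟨hD1, -⟩ := derPreserving.mem_superDer hD
  obtain ⟨hE1, -⟩ := derPreserving.mem_superDer hE
  refine sub_eq_zero.1 (eq_zero_of_mem_generators {br (𝕜 := 𝕜) (toEnd (outer h hV D))
    (toEnd (outer h hV E)) - toEnd (outer h hV (br (𝕜 := 𝕜) D E))} ?_ ?_ rfl)
  · rintro _ rfl f
    have h1 := br_toEnd_apply_nil hQ hR f
    have h0 : ∀ D, (outer h hV D).1 [] = 0 := fun _ => rfl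
    have h0' : ∀ D, (outer h hV D).1 [0] = 0 := fun D => congrFun (rawShift_zero (outer h hV D).2) []
    rw [h0, h0, h0', h0', smul_zero, sub_zero] at h1
    exact sub_eq_zero.2 h1
  · rintro _ rfl k u hu
    have hu' : V.incl u ∈ part (𝕜 := 𝕜) (V := L) k := hu
    have hb : (derPreserving K).incl (br (𝕜 := 𝕜) D E) =
      br (𝕜 := 𝕜) ((derPreserving K).incl D) ((derPreserving K).incl E) := rfl
    convert Submodule.zero_mem _ using 1
    rw [map_sub, LinearMap.sub_apply, br_br hQ.toEnd_mem hR.toEnd_mem (pderiv_mem hu).1,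
      br_toEnd_pderiv _ hu, br_toEnd_pderiv _ hu, br_toEnd_pderiv _ hu, shift_outer, shift_outer,
      shift_outer, br_toEnd_outer_inner h hV hD (hE1 k _ hu'),
      br_toEnd_outer_inner h hV hE (hD1 k _ hu'), hb, br_apply_of_mem hD1 hE1, map_sub, map_sub,
      map_smul, map_smul, sub_self]

theorem toEnd_outer_mem (D : (derPreserving K).Elem) :
    toEnd (outer h hV D) ∈ (formalVect 𝕜 V.Elem).toSubmodule := by
  refine hom_induction (𝕜 := 𝕜)
    (p := fun D => toEnd (outer h hV D) ∈ (formalVect 𝕜 V.Elem).toSubmodule) D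
    (fun D E hD hE => ?_) fun i D hD => (outer_hasParity h hV hD).toEnd_mem_formalVect
  rw [map_add, map_add]
  exact add_mem hD hE

/-- The homomorphism that sends a derivation to the formal vector field that encodes its higher
derived brackets. -/
def toVect : LieSuperHom 𝕜 (derPreserving K).Elem (formalVect 𝕜 V.Elem).Elem where
  toFun D := (⟨toEnd (outer h hV D), toEnd_outer_mem h hV D⟩ : (formalVect 𝕜 V.Elem).toSubmodule)
  map_add' D E := Subtype.ext (map_add (toEnd ∘ₗ outer h hV) D E)
  map_smul' c D := Subtype.ext (map_smul (toEnd ∘ₗ outer h hV) c D)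
  map_part i D hD := (outer_hasParity h hV hD).toEnd_mem
  map_br D E := Subtype.ext (by
    change toEnd (outer h hV (br (𝕜 := 𝕜) D E)) =
      br (𝕜 := 𝕜) (toEnd (outer h hV D)) (toEnd (outer h hV E))
    -- Both sides are bilinear, so homogeneous derivations suffice.
    refine hom_induction (𝕜 := 𝕜) (p := fun D => toEnd (outer h hV (br (𝕜 := 𝕜) D E)) =
      br (𝕜 := 𝕜) (toEnd (outer h hV D)) (toEnd (outer h hV E))) D
      (fun D D' hD hD' => by simp only [map_add, LinearMap.add_apply, hD, hD']) fun i D hD => ?_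
    refine hom_induction (𝕜 := 𝕜) (p := fun E => toEnd (outer h hV (br (𝕜 := 𝕜) D E)) =
      br (𝕜 := 𝕜) (toEnd (outer h hV D)) (toEnd (outer h hV E))) E
      (fun E E' hE hE' => by simp only [map_add, hE, hE']) fun j E hE => ?_
    exact (br_toEnd_outer h hV hD hE).symm)

end DerivedBracket

/-! ### Recovering the coefficients, and the theorem. -/

namespace FormalMap

variable {𝕜 : Type*} {V : Type*} [Field 𝕜] [CharZero 𝕜] [AddCommGroup V] [Module 𝕜 V]
  [Superspace 𝕜 V]

/-- Each bracket with a constant field feeds its vector into the coefficients. Since the vectors may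
be inhomogeneous, `br_toEnd_pderiv` is applied to their even and odd components. -/
theorem iterBr_toEnd_apply_nil (c : formalMaps 𝕜 V) (l : List V) (f : FormalFunction 𝕜 V) :
    (iterBr 𝕜 (toEnd c) (l.map pderiv) f).1 [] = f.1 [c.1 l] := by
  induction l generalizing c with
  | nil => rfl
  | cons u l ih =>
    have hs : shift u c = shift (even 𝕜 u) c + shift (odd 𝕜 u) c := by
      have h := rawShift_add (even 𝕜 u) (odd 𝕜 u) c.2
      rw [even_add_odd] at h
      exact Subtype.ext h
    have hb : br (𝕜 := 𝕜) (toEnd c) (pderiv u) = toEnd (shift u c) := by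
      rw [hs, map_add, ← br_toEnd_pderiv c (even_mem 𝕜 u), ← br_toEnd_pderiv c (odd_mem 𝕜 u),
        ← map_add, ← pderiv_add, even_add_odd]
    rw [List.map_cons, iterBr_cons, hb]
    exact ih _

end FormalMap

theorem formalVect.incl_iterBr_const {𝕜 V : Type*} [Field 𝕜] [CharZero 𝕜] [AddCommGroup V]
    [Module 𝕜 V] [Superspace 𝕜 V] (Q : (formalVect 𝕜 V).Elem) (l : List V) :
    (formalVect 𝕜 V).incl (iterBr 𝕜 Q (l.map formalVect.const)) =
      iterBr 𝕜 ((formalVect 𝕜 V).incl Q) (l.map pderiv) := by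
  rw [LieSubsuperalgebra.incl_iterBr, List.map_map]
  rfl

end

theorem mainTheorem3 {𝕜 L : Type*} [Field 𝕜] [CharZero 𝕜] [AddCommGroup L] [Module 𝕜 L]
    [LieSuperalgebra 𝕜 L] (K V : LieSubsuperalgebra 𝕜 L)
    (hKV : IsCompl V.toSubmodule K.toSubmodule)
    (hV : ∀ a ∈ V.toSubmodule, ∀ b ∈ V.toSubmodule, LieSuperalgebra.br (𝕜 := 𝕜) a b = 0) :
    ∃ Φ : LieSuperHom 𝕜 (derPreserving K).Elem (formalVect 𝕜 V.Elem).Elem,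
      ∀ (D : (derPreserving K).Elem) (Q : (formalVect 𝕜 V.Elem).Elem),
        EncodesDerivedBrackets K V hKV D Q ↔ Q = Φ.toLinearMap D := by
  refine ⟨DerivedBracket.toVect hKV hV, fun D Q => ⟨fun ⟨hQ0, hQ⟩ => ?_, ?_⟩⟩
  · let c := DerivedBracket.outer hKV hV D
    let A := (formalVect 𝕜 V.Elem).incl Q - FormalMap.toEnd c
    -- Uniqueness: the iterated brackets of the difference `A` with constant fields form a family
    -- stable under further such brackets, and all vanish at the origin because `Q` and `toEnd c`
    -- have the same values there.
    refine Subtype.ext (sub_eq_zero.1 (eq_zero_of_mem_generators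
      {B | ∃ l : List V.Elem, B = iterBr 𝕜 A (l.map pderiv)} ?_ ?_ (A := A) ⟨[], rfl⟩))
    · rintro _ ⟨l, rfl⟩ f
      have h1 : (iterBr 𝕜 ((formalVect 𝕜 V.Elem).incl Q) (l.map pderiv) f).1 [] = f.1 [c.1 l] := by
        cases l with
        -- The empty word is the condition `Q(0) = 0`, since `c [] = 0` by definition.
        | nil => exact hQ0 f
        | cons a l =>
          rw [← formalVect.incl_iterBr_const]
          exact hQ a l f
      rw [iterBr_sub]
      exact sub_eq_zero.2 (h1.trans (FormalMap.iterBr_toEnd_apply_nil c l f).symm)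
    · rintro _ ⟨l, rfl⟩ k u -
      refine Submodule.subset_span ⟨l ++ [u], ?_⟩
      rw [List.map_append, iterBr_append]
      rfl
  · rintro rfl
    refine ⟨fun f => rfl, fun a l f => ?_⟩
    rw [formalVect.incl_iterBr_const]
    exact FormalMap.iterBr_toEnd_apply_nil (DerivedBracket.outer hKV hV D) (a :: l) f
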